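/- Let $\operatorname{Pic}=\mathbb Z\mathcal H_x\oplus\mathbb Z\mathcal H_y\oplus\bigoplus_{i=1}^8\mathbb Z\mathcal E_i$ be the Picard lattice of $\mathbb P^1\times\mathbb P^1$ blown up at eight points, with $\mathcal H_x\bullet\mathcal H_y=1$, $\mathcal E_i\bullet\mathcal E_j=-\delta_{ij}$ and all other products of these basis elements equal to $0$. Put $\delta=2\mathcal H_x+2\mathcal H_y-\sum_i\mathcal E_i$, and let $w_a(D)=D+(a\bullet D)a$ for $a\in\operatorname{Pic}$ with $a\bullet a=-2$. Let $W(E_8^{(1)})$ be the group of automorphisms of $\operatorname{Pic}$ generated by the reflections in $\alpha_0=\mathcal E_1-\mathcal E_2$, $\alpha_1=\mathcal H_x-\mathcal H_y$, $\alpha_2=\mathcal H_y-\mathcal E_1-\mathcal E_2$, $\alpha_j=\mathcal E_{j-1}-\mathcal E_j$ $(3\le j\le 8)$. Let $\mathbb T=\mathbb C/(\mathbb Z+\mathbb Z\tau)$ with $\operatorname{Im}\tau>0$. A choice of parameters $h_x,h_y,e_1,\dots,e_8\in\mathbb T$ defines a homomorphism $\iota^*:\operatorname{Pic}\to\mathbb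 T$ by $\mathcal H_x\mapsto h_x$, $\mathcal H_y\mapsto h_y$, $\mathcal E_i\mapsto e_i$; an element $w$, with $w^*=w^{-1}$ on $\operatorname{Pic}$, sends the parameters to $\bar h_x=\iota^*(w^*\mathcal H_x)$, $\bar h_y=\iota^*(w^*\mathcal H_y)$, $\bar e_i=\iota^*(w^*\mathcal E_i)$. Consider the condition $$(\ast)\qquad e_1+e_2-e_5-e_6=0,\qquad e_3+e_4-e_7-e_8=0\qquad\text{in }\mathbb T .$$ Let $\Gamma$ be the subgroup of those $w\in W(E_8^{(1)})$ such that the new parameters satisfy $(\ast)$ if and only if the old ones do. Put $$\beta_0=\mathcal E_1-\mathcal E_2,\ \ \beta_1=\mathcal E_5-\mathcal E_6,\ \ \beta_2=\mathcal H_y-\mathcal E_1-\mathcal E_5,\ \ \beta_3=\mathcal H_x-\mathcal H_y,\ \ \beta_4=\mathcal H_y-\mathcal E_3-\mathcal E_7,\ \ \beta_5=\mathcal E_3-\mathcal E_4,\ \ \beta_6=\mathcal E_7-\mathcal E_8,$$ and let $\sigma_1=(\mathcal E_1\mathcal E_3\mathcal E_5\mathcal E_7)(\mathcal E_2\mathcal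 E_4\mathcal E_6\mathcal E_8)$ and $\sigma_2=(\mathcal E_1\mathcal E_5)(\mathcal E_2\mathcal E_6)$ act on $\operatorname{Pic}$ by permuting the $\mathcal E_i$ and fixing $\mathcal H_x,\mathcal H_y$. Then the following hold. 1. $\Gamma$ is generated by $w_{\beta_0},\dots,w_{\beta_6},\sigma_1,\sigma_2$. Moreover $w\in W(E_8^{(1)})$ already lies in $\Gamma$ if $w$ sends all parameters satisfying $(\ast)$ to parameters satisfying $(\ast)$, or if it does so for a single choice of parameters satisfying $(\ast)$ that is generic in the sense that $\iota^*\beta_0,\dots,\iota^*\beta_6$ are linearly independent over $\mathbb Z$; such generic parameters exist. 2. $\beta_0=\alpha_0$, $\beta_1=\alpha_6$, $\beta_2=\alpha_2+\alpha_3+\alpha_4+\alpha_5$, $\beta_3=\alpha_1$, $\beta_4=\alpha_0+\alpha_2+2\alpha_3+\alpha_4+\alpha_5+\alpha_6+\alpha_7$, $\beta_5=\alpha_4$, $\beta_6=\alpha_8$. The $\beta_i$ are linearly independent, and $(-\beta_i\bullet\beta_j)$ is the generalized Cartan matrix of type $D_6^{(1)}$, with diagram edges $02,12,23,34,45,46$.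 3. Let $W(D_6^{(1)})$ be the Weyl group of this matrix (generated by the fundamental reflections of the root lattice) and $\operatorname{Aut}(D_6^{(1)})$ the group of diagram automorphisms. Then $\Gamma$ is isomorphic to the extended affine Weyl group $\widetilde W(D_6^{(1)})=\operatorname{Aut}(D_6^{(1)})\ltimes W(D_6^{(1)})$, by an isomorphism that takes $w_{\beta_i}$ to the $i$-th fundamental reflection and $\sigma_1,\sigma_2$ to the diagram automorphisms $(0\,5\,1\,6)(2\,4)$ and $(0\,1)$; accordingly $\sigma_1=(\beta_0\beta_5\beta_1\beta_6)(\beta_2\beta_4)$ and $\sigma_2=(\beta_0\beta_1)$ on the $\beta_i$. The group $\operatorname{Aut}(D_6^{(1)})$ is the dihedral group of order $8$, $\langle\sigma_1,\sigma_2\mid\sigma_1^4=\sigma_2^2=(\sigma_2\sigma_1)^2=e\rangle$, and $\sigma_1^2$ exchanges $\beta_0$ with $\beta_1$ and $\beta_5$ with $\beta_6$. 4. Let $\varphi^*$ be the automorphism of $\operatorname{Pic}$ given by $\mathcal H_x\mapsto2\mathcal H_x+\mathcal H_y-\mathcal E_3-\mathcal E_4-\mathcal E_7-\mathcal E_8$,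 $\mathcal H_y\mapsto\mathcal H_x$, $\mathcal E_1\mapsto\mathcal H_x-\mathcal E_3$, $\mathcal E_2\mapsto\mathcal H_x-\mathcal E_4$, $\mathcal E_3\mapsto\mathcal E_2$, $\mathcal E_4\mapsto\mathcal E_1$, $\mathcal E_5\mapsto\mathcal H_x-\mathcal E_7$, $\mathcal E_6\mapsto\mathcal H_x-\mathcal E_8$, $\mathcal E_7\mapsto\mathcal E_6$, $\mathcal E_8\mapsto\mathcal E_5$, and put $\varphi_*=(\varphi^*)^{-1}$, $(\varphi^2)^*=(\varphi^*)^2$, $(\varphi^2)_*=(\varphi_*)^2$. Then $$\varphi^*:(\beta_0,\dots,\beta_6)\mapsto(-\beta_5,\,-\beta_6,\,-\beta_3-\beta_4,\,\beta_3+2\beta_4+\beta_5+\beta_6,\,\beta_0+\beta_1+\beta_2+\beta_3,\,-\beta_0,\,-\beta_1),$$ which is not a translation on $Q_B=\operatorname{Span}_{\mathbb Z}\{\beta_0,\dots,\beta_6\}$ (it does not move every element of $Q_B$ by an integer multiple of $\delta$), whereas $(\varphi^2)^*$ is a translation on $Q_B$, $$(\varphi^2)^*:(\beta_0,\dots,\beta_6)\mapsto(\beta_0,\dots,\beta_6)+(0,0,-1,1,0,0,0)\,\delta,\qquad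 \delta=\beta_0+\beta_1+2\beta_2+2\beta_3+2\beta_4+\beta_5+\beta_6 .$$ 5. With products read as compositions of maps from right to left and $w_i=w_{\beta_i}$, $$\varphi^*=\sigma_1^3w_6w_5w_3w_2w_1w_0w_2w_1w_0,\qquad(\varphi^2)^*=\sigma_1^2w_3w_4w_6w_5w_4w_3w_2w_1w_0w_2,$$ equivalently $$\varphi_*=w_0w_1w_2w_0w_1w_2w_3w_5w_6\,\sigma_1,\qquad(\varphi^2)_*=w_2w_0w_1w_2w_3w_4w_5w_6w_4w_3\,\sigma_1^2 .$$ -/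

import Mathlib

namespace EllipticD6

/-! ### The Picard lattice of `ℙ¹ × ℙ¹` blown up at eight points -/

/-- `Pic(𝓧) = ℤ 𝓗_x ⊕ ℤ 𝓗_y ⊕ ℤ 𝓔₁ ⊕ ⋯ ⊕ ℤ 𝓔₈`, in coordinates. -/
abbrev Pic : Type := Fin 2 ⊕ Fin 8 → ℤ

/-- The class `𝓗_x` of vertical lines. -/
def Hx : Pic := Pi.single (Sum.inl 0) 1

/-- The class `𝓗_y` of horizontal lines. -/
def Hy : Pic := Pi.single (Sum.inl 1) 1

/-- The exceptional classes; `E k` is `𝓔_{k+1}`, so that `E 0, …, E 7` are `𝓔₁, …, 𝓔₈`. -/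
def E (k : Fin 8) : Pic := Pi.single (Sum.inr k) 1

/-- The intersection form: `𝓗_x • 𝓗_y = 1`, `𝓔_i • 𝓔_j = -δ_{ij}`, other products of the
basis classes vanish. -/
def inter : LinearMap.BilinForm ℤ Pic :=
  LinearMap.mk₂ ℤ
    (fun D D' => D (Sum.inl 0) * D' (Sum.inl 1) + D (Sum.inl 1) * D' (Sum.inl 0)
      - ∑ k : Fin 8, D (Sum.inr k) * D' (Sum.inr k))
    (by intro a b c; simp [add_mul, Finset.sum_add_distrib]; ring)
    (by intro r a b; simp [mul_assoc, ← Finset.mul_sum]; ring)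
    (by intro a b c; simp [mul_add, Finset.sum_add_distrib]; ring)
    (by
      intro r a b
      simp only [Pi.smul_apply, smul_eq_mul, mul_left_comm _ r _, ← Finset.mul_sum]
      ring)

/-- The class `δ = -K = 2𝓗_x + 2𝓗_y - 𝓔₁ - ⋯ - 𝓔₈` of the anti-canonical divisor. -/
def delta : Pic := (2 : ℤ) • Hx + (2 : ℤ) • Hy - ∑ k : Fin 8, E k

/-- The reflection `D ↦ D + (a • D) a` in a class `a` with `a • a = -2`. -/
def refl (a : Pic) (h : inter a a = -2) : Pic ≃ₗ[ℤ] Pic :=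
  Module.reflection (x := a) (f := -(inter a)) (by simp [h])

theorem refl_apply (a : Pic) (h : inter a a = -2) (D : Pic) :
    refl a h D = D + inter a D • a := by
  simp [refl, Module.reflection_apply]

/-! ### The affine Weyl group of type `E₈⁽¹⁾` -/

/-- The simple roots `α₀, …, α₈` of type `E₈⁽¹⁾`. -/
def alpha : Fin 9 → Pic :=
  ![E 0 - E 1, Hx - Hy, Hy - E 0 - E 1, E 1 - E 2, E 2 - E 3, E 3 - E 4, E 4 - E 5, E 5 - E 6,
    E 6 - E 7]

theorem alpha_sq (i : Fin 9) : inter (alpha i) (alpha i) = -2 := by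
  revert i; decide

/-- `W(E₈⁽¹⁾)`, acting on `Pic(𝓧)`: the group generated by the reflections in `α₀, …, α₈`. -/
def weylE8 : Subgroup (Pic ≃ₗ[ℤ] Pic) :=
  Subgroup.closure (Set.range fun i => refl (alpha i) (alpha_sq i))

/-! ### Parameters on the elliptic curve and the constraint -/

/-- The elliptic curve `𝕋 = ℂ / (ℤ + ℤ τ)`, identified with its Picard group in which the class
of a point is that point. -/
abbrev Torus (τ : ℂ) : Type := ℂ ⧸ AddSubgroup.closure ({1, τ} : Set ℂ)

/-- The parameters `h_x, h_y, e₁, …, e₈`, points of a group `T`; `e k` is `e_{k+1}`. -/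
structure Parameters (T : Type*) where
  hx : T
  hy : T
  e : Fin 8 → T

namespace Parameters

variable {T : Type*} [AddCommGroup T]

/-- The pull-back `ι^* : Pic(𝓧) → 𝕋`, the homomorphism with `𝓗_x ↦ h_x`, `𝓗_y ↦ h_y`,
`𝓔_i ↦ e_i`. -/
def pullback (p : Parameters T) : Pic →ₗ[ℤ] T :=
  Fintype.linearCombination ℤ (Sum.elim ![p.hx, p.hy] p.e)

/-- The evolution of the parameters under `w`. Here `w` stands for the push-forward action `w_*`
on the Picard lattice, so that the pull-back action `w^*` is its inverse, and the new parameters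
are `h̄_x = ι^*(w^* 𝓗_x)`, `h̄_y = ι^*(w^* 𝓗_y)`, `ē_i = ι^*(w^* 𝓔_i)`. -/
def evolve (p : Parameters T) (w : Pic ≃ₗ[ℤ] Pic) : Parameters T where
  hx := p.pullback (w⁻¹ Hx)
  hy := p.pullback (w⁻¹ Hy)
  e := fun k => p.pullback (w⁻¹ (E k))

/-- The condition `e₁ + e₂ - e₅ - e₆ = 0`, `e₃ + e₄ - e₇ - e₈ = 0`. -/
def Constraint (p : Parameters T) : Prop :=
  p.e 0 + p.e 1 - p.e 4 - p.e 5 = 0 ∧ p.e 2 + p.e 3 - p.e 6 - p.e 7 = 0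

theorem pullback_Hx (p : Parameters T) : p.pullback Hx = p.hx := by
  simp [pullback, Hx, Fintype.linearCombination_apply_single]

theorem pullback_Hy (p : Parameters T) : p.pullback Hy = p.hy := by
  simp [pullback, Hy, Fintype.linearCombination_apply_single]

theorem pullback_E (p : Parameters T) (k : Fin 8) : p.pullback (E k) = p.e k := by
  simp [pullback, E, Fintype.linearCombination_apply_single]

theorem pullback_evolve (p : Parameters T) (w : Pic ≃ₗ[ℤ] Pic) (D : Pic) :
    (p.evolve w).pullback D = p.pullback (w⁻¹ D) := by
  have h : (p.evolve w).pullback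
      = p.pullback ∘ₗ ((w⁻¹ : Pic ≃ₗ[ℤ] Pic) : Pic →ₗ[ℤ] Pic) := by
    refine (Pi.basisFun ℤ (Fin 2 ⊕ Fin 8)).ext fun i => ?_
    rw [Pi.basisFun_apply]
    rcases i with i | k
    · fin_cases i
      · exact pullback_Hx _
      · exact pullback_Hy _
    · exact pullback_E _ k
  rw [h]; rfl

theorem evolve_one (p : Parameters T) : p.evolve 1 = p := by
  cases p with
  | mk hx hy e =>
    simp only [evolve, inv_one, LinearEquiv.coe_one, id_eq, pullback_Hx, pullback_Hy, pullback_E]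

theorem evolve_mul (p : Parameters T) (v w : Pic ≃ₗ[ℤ] Pic) :
    p.evolve (v * w) = (p.evolve w).evolve v := by
  have key : ∀ D, p.pullback ((v * w)⁻¹ D) = (p.evolve w).pullback (v⁻¹ D) := by
    intro D; rw [pullback_evolve, mul_inv_rev]; rfl
  simp only [evolve, Parameters.mk.injEq]
  exact ⟨key _, key _, funext fun k => key _⟩

end Parameters

/-- The elements of `W(E₈⁽¹⁾)` that preserve the constraint: a point of the parameter space
satisfies the constraint if and only if its image does. -/
def preservingSubgroup (τ : ℂ) : Subgroup (Pic ≃ₗ[ℤ] Pic) where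
  carrier := {w | w ∈ weylE8 ∧
    ∀ p : Parameters (Torus τ), (p.evolve w).Constraint ↔ p.Constraint}
  one_mem' := ⟨weylE8.one_mem, fun p => by rw [Parameters.evolve_one]⟩
  mul_mem' := by
    rintro v w ⟨hv, hv'⟩ ⟨hw, hw'⟩
    exact ⟨weylE8.mul_mem hv hw, fun p => by rw [Parameters.evolve_mul, hv', hw']⟩
  inv_mem' := by
    rintro w ⟨hw, hw'⟩
    refine ⟨weylE8.inv_mem hw, fun p => ?_⟩
    rw [← hw' (p.evolve w⁻¹), ← Parameters.evolve_mul, mul_inv_cancel, Parameters.evolve_one]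

/-! ### The roots `β₀, …, β₆` and the automorphisms `σ₁, σ₂` -/

/-- The roots `β₀, …, β₆`. -/
def beta : Fin 7 → Pic :=
  ![E 0 - E 1, E 4 - E 5, Hy - E 0 - E 4, Hx - Hy, Hy - E 2 - E 6, E 2 - E 3, E 6 - E 7]

theorem beta_sq (i : Fin 7) : inter (beta i) (beta i) = -2 := by
  revert i; decide

/-- The reflection `w_{β_i}` of `Pic(𝓧)`. -/
def wBeta (i : Fin 7) : Pic ≃ₗ[ℤ] Pic := refl (beta i) (beta_sq i)

/-- The sublattice `Q_B` spanned by `β₀, …, β₆`. -/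
def latticeB : Submodule ℤ Pic := Submodule.span ℤ (Set.range beta)

/-- The parameters are generic for the constrained family when `ι^* β₀, …, ι^* β₆` are linearly
independent over `ℤ`. -/
def Parameters.IsGeneric {T : Type*} [AddCommGroup T] (p : Parameters T) : Prop :=
  LinearIndependent ℤ fun i : Fin 7 => p.pullback (beta i)

/-- The automorphism of `Pic(𝓧)` that fixes `𝓗_x, 𝓗_y` and permutes the exceptional classes by
`E k ↦ E (π k)`. -/
def permE (π : Equiv.Perm (Fin 8)) : Pic ≃ₗ[ℤ] Pic :=
  LinearEquiv.funCongrLeft ℤ ℤ (Equiv.sumCongr (Equiv.refl (Fin 2)) π).symm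

/-- `σ₁ = (𝓔₁ 𝓔₃ 𝓔₅ 𝓔₇)(𝓔₂ 𝓔₄ 𝓔₆ 𝓔₈)`. -/
def sigma1 : Pic ≃ₗ[ℤ] Pic := permE (c[0, 2, 4, 6] * c[1, 3, 5, 7])

/-- `σ₂ = (𝓔₁ 𝓔₅)(𝓔₂ 𝓔₆)`. -/
def sigma2 : Pic ≃ₗ[ℤ] Pic := permE (c[0, 4] * c[1, 5])

/-- An endomorphism acts as a translation on a sublattice `L` when it moves every element of `L`
by an integer multiple of `δ`. -/
def IsTranslationOn (L : Submodule ℤ Pic) (f : Pic ≃ₗ[ℤ] Pic) : Prop :=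
  ∀ x ∈ L, ∃ n : ℤ, f x = x + n • delta

/-! ### The action of the mapping `φ` -/

/-- The images of `𝓗_x, 𝓗_y, 𝓔₁, …, 𝓔₈` under `φ_*`. -/
def phiPushImages : Fin 2 ⊕ Fin 8 → Pic :=
  Sum.elim ![Hy, Hx + (2 : ℤ) • Hy - E 0 - E 1 - E 4 - E 5]
    ![E 3, E 2, Hy - E 0, Hy - E 1, E 7, E 6, Hy - E 4, Hy - E 5]

/-- The images of `𝓗_x, 𝓗_y, 𝓔₁, …, 𝓔₈` under `φ^*`. -/
def phiPullImages : Fin 2 ⊕ Fin 8 → Pic :=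
  Sum.elim ![(2 : ℤ) • Hx + Hy - E 2 - E 3 - E 6 - E 7, Hx]
    ![Hx - E 2, Hx - E 3, E 1, E 0, Hx - E 6, Hx - E 7, E 5, E 4]

/-- The push-forward action `φ_*` on `Pic(𝓧)`. -/
def phiPush : Pic ≃ₗ[ℤ] Pic :=
  LinearEquiv.ofLinearMap (Fintype.linearCombination ℤ phiPushImages)
    (Fintype.linearCombination ℤ phiPullImages)
    (by
      refine (Pi.basisFun ℤ (Fin 2 ⊕ Fin 8)).ext fun i => ?_
      rw [Pi.basisFun_apply, LinearMap.comp_apply, Fintype.linearCombination_apply_single,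
        one_smul, LinearMap.id_apply, Fintype.linearCombination_apply]
      revert i; decide)
    (by
      refine (Pi.basisFun ℤ (Fin 2 ⊕ Fin 8)).ext fun i => ?_
      rw [Pi.basisFun_apply, LinearMap.comp_apply, Fintype.linearCombination_apply_single,
        one_smul, LinearMap.id_apply, Fintype.linearCombination_apply]
      revert i; decide)

/-- The pull-back action `φ^* = (φ_*)⁻¹` on `Pic(𝓧)`. -/
def phiPull : Pic ≃ₗ[ℤ] Pic := phiPush⁻¹

theorem phiPull_apply (D : Pic) : phiPull D = Fintype.linearCombination ℤ phiPullImages D := rfl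

/-! ### The extended affine Weyl group of type `D₆⁽¹⁾` -/

/-- The generalized Cartan matrix of type `D₆⁽¹⁾`, for the Dynkin diagram with the edges
`0 — 2`, `1 — 2`, `2 — 3`, `3 — 4`, `4 — 5`, `4 — 6`. -/
def cartanD6 : Matrix (Fin 7) (Fin 7) ℤ :=
  !![ 2,  0, -1,  0,  0,  0,  0;
      0,  2, -1,  0,  0,  0,  0;
     -1, -1,  2, -1,  0,  0,  0;
      0,  0, -1,  2, -1,  0,  0;
      0,  0,  0, -1,  2, -1, -1;
      0,  0,  0,  0, -1,  2,  0;
      0,  0,  0,  0, -1,  0,  2]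

/-- The abstract root lattice of type `D₆⁽¹⁾`, free on the simple roots `Pi.single i 1`. -/
abbrev RootLatticeD6 : Type := Fin 7 → ℤ

/-- The `i`-th fundamental reflection `a_j ↦ a_j - A_{ij} a_i` of the abstract root lattice. -/
def simpleReflD6 (i : Fin 7) : RootLatticeD6 ≃ₗ[ℤ] RootLatticeD6 :=
  Module.reflection (x := Pi.single i 1) (f := Fintype.linearCombination ℤ (cartanD6 i))
    (by rw [Fintype.linearCombination_apply_single, one_smul]; revert i; decide)

/-- The affine Weyl group `W(D₆⁽¹⁾)`, generated by the fundamental reflections. -/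
def weylD6 : Subgroup (RootLatticeD6 ≃ₗ[ℤ] RootLatticeD6) :=
  Subgroup.closure (Set.range simpleReflD6)

/-- `Aut(D₆⁽¹⁾)`: the permutations of the simple roots that preserve the Cartan matrix, i.e. the
automorphisms of the Dynkin diagram. -/
def autD6 : Subgroup (Equiv.Perm (Fin 7)) where
  carrier := {π | ∀ i j, cartanD6 (π i) (π j) = cartanD6 i j}
  one_mem' := fun _ _ => rfl
  mul_mem' := by
    intro π ρ hπ hρ i j
    rw [Equiv.Perm.mul_apply, Equiv.Perm.mul_apply, hπ, hρ]
  inv_mem' := by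
    intro π hπ i j
    rw [← hπ (π⁻¹ i) (π⁻¹ j), ← Equiv.Perm.mul_apply, ← Equiv.Perm.mul_apply, mul_inv_cancel,
      Equiv.Perm.one_apply, Equiv.Perm.one_apply]

/-- A permutation of the simple roots, extended linearly to the root lattice: `a_i ↦ a_{π i}`. -/
def permLattice : Equiv.Perm (Fin 7) →* (RootLatticeD6 ≃ₗ[ℤ] RootLatticeD6) where
  toFun π := LinearEquiv.funCongrLeft ℤ ℤ π.symm
  map_one' := rfl
  map_mul' _ _ := rfl

theorem permLattice_conj (π : autD6) (i : Fin 7) :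
    permLattice π * simpleReflD6 i * (permLattice π)⁻¹ = simpleReflD6 (π.1 i) := by
  rw [mul_inv_eq_iff_eq_mul]
  refine LinearEquiv.toLinearMap_injective ((Pi.basisFun ℤ (Fin 7)).ext fun j => ?_)
  have hp : ∀ k, permLattice π (Pi.single k 1) = Pi.single (π.1 k) 1 := by
    intro k
    ext l
    simp [permLattice, LinearEquiv.funCongrLeft, LinearMap.funLeft, Pi.single_apply,
      Equiv.symm_apply_eq]
  simp only [LinearEquiv.coe_coe, Pi.basisFun_apply, LinearEquiv.mul_apply, simpleReflD6,
    Module.reflection_apply, map_sub, map_smul, hp, Fintype.linearCombination_apply_single,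
    one_smul, π.2 i j]

theorem permLattice_mem_normalizer (π : autD6) :
    permLattice π ∈ Subgroup.normalizer (weylD6 : Set (RootLatticeD6 ≃ₗ[ℤ] RootLatticeD6)) := by
  have key : ∀ (ρ : autD6), ∀ w ∈ weylD6, permLattice ρ * w * (permLattice ρ)⁻¹ ∈ weylD6 := by
    intro ρ w hw
    have : weylD6 ≤ weylD6.comap (MulAut.conj (permLattice ρ)).toMonoidHom := by
      conv_lhs => rw [weylD6]
      rw [Subgroup.closure_le]
      rintro _ ⟨i, rfl⟩
      show permLattice ρ * simpleReflD6 i * (permLattice ρ)⁻¹ ∈ weylD6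
      rw [permLattice_conj]
      exact Subgroup.subset_closure ⟨_, rfl⟩
    exact this hw
  rw [Subgroup.mem_normalizer_iff]
  intro w
  refine ⟨key π w, fun h => ?_⟩
  have := key π⁻¹ _ h
  simpa [mul_assoc] using this

/-- The action of `Aut(D₆⁽¹⁾)` on `W(D₆⁽¹⁾)`, by conjugation. -/
def autAction : autD6 →* MulAut weylD6 :=
  weylD6.normalizerMonoidHom.comp
    ((permLattice.comp autD6.subtype).codRestrict _ permLattice_mem_normalizer)

/-- The extended affine Weyl group `W̃(D₆⁽¹⁾) = Aut(D₆⁽¹⁾) ⋉ W(D₆⁽¹⁾)`. -/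
abbrev ExtendedWeylD6 : Type := weylD6 ⋊[autAction] autD6

/-- The generator of `W(D₆⁽¹⁾) ≤ W̃(D₆⁽¹⁾)` at the node `i`. -/
def simpleGen (i : Fin 7) : ExtendedWeylD6 :=
  SemidirectProduct.inl ⟨simpleReflD6 i, Subgroup.subset_closure ⟨i, rfl⟩⟩

/-- The permutation `(0 5 1 6)(2 4)` of the nodes of the Dynkin diagram. -/
def perm1 : Equiv.Perm (Fin 7) := c[0, 5, 1, 6] * c[2, 4]

/-- The permutation `(0 1)` of the nodes of the Dynkin diagram. -/
def perm2 : Equiv.Perm (Fin 7) := c[0, 1]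

theorem perm1_mem (i j : Fin 7) : cartanD6 (perm1 i) (perm1 j) = cartanD6 i j := by
  revert j; fin_cases i <;> decide

theorem perm2_mem (i j : Fin 7) : cartanD6 (perm2 i) (perm2 j) = cartanD6 i j := by
  revert j; fin_cases i <;> decide

/-- The diagram automorphism `(β₀ β₅ β₁ β₆)(β₂ β₄)`. -/
def diagram1 : autD6 := ⟨perm1, perm1_mem⟩

/-- The diagram automorphism `(β₀ β₁)`. -/
def diagram2 : autD6 := ⟨perm2, perm2_mem⟩

/-- The relators `s₁⁴`, `s₂²`, `(s₂ s₁)²` in the free group on two letters `s₁, s₂`. -/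
def dihedralRelators : Set (FreeGroup (Fin 2)) :=
  {FreeGroup.of 0 ^ 4, FreeGroup.of 1 ^ 2, (FreeGroup.of 1 * FreeGroup.of 0) ^ 2}

end EllipticD6

namespace EllipticD6

/-!
A generic point of the constrained family kills no class of `δ^⊥` outside the span of the two
constrained classes `A` and `B`, so an element of `W(E₈⁽¹⁾)` that keeps one such point in the
family maps `A` and `B` into `ℤ A + ℤ B`. There the orthogonal pairs of norm `-4` are permuted
simply transitively by `⟨σ₁, σ₂⟩`, which reduces the first claim to the isometries fixing `δ`, `A`
and `B`. Such an isometry `g` preserves `(A, B, δ)^⊥ = Q_B`. Let `ρ` have `β_i • ρ = 1` for all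
`i`. As the form is negative semidefinite on `δ^⊥`, reflecting `g⁻¹ ρ` in the `β_i` that it pairs
negatively with lowers `ρ • g⁻¹ ρ` and must stop; after that `g` permutes the `β_i`, and it fixes
all of them because it acts trivially on `Pic / Q_B`, on which a diagram automorphism is seen by
its effect on the four leaves of the diagram. The same rigidity makes the product of `⟨w_{β_i}⟩`
and `⟨σ₁, σ₂⟩` semidirect.
-/

section CartanMatrix

open Matrix

variable {ι : Type*} [Fintype ι]

theorem posPart_form_add_negPart_form_le {R : Type*} [CommRing R] [LinearOrder R]
    [IsStrictOrderedRing R] {A : Matrix ι ι R} (hA : ∀ i j, i ≠ j → A i j ≤ 0) (n : ι → R) :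
    n⁺ ⬝ᵥ A *ᵥ n⁺ + n⁻ ⬝ᵥ A *ᵥ n⁻ ≤ n ⬝ᵥ A *ᵥ n := by
  simp only [dotProduct, mulVec, Finset.mul_sum, ← Finset.sum_add_distrib]
  refine Finset.sum_le_sum fun i _ => Finset.sum_le_sum fun j _ => ?_
  have hsplit (k : ι) : n k = n⁺ k - n⁻ k := congrFun (posPart_sub_negPart n).symm k
  have hcross : A i j * (n⁺ i * n⁻ j + n⁻ i * n⁺ j) ≤ 0 := by
    rcases eq_or_ne i j with rfl | hij
    · have : n⁺ i * n⁻ i = 0 := by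
        rcases le_total 0 (n i) with h | h
        · simp [Pi.negPart_apply, h]
        · simp [Pi.posPart_apply, h]
      rw [mul_comm (n⁻ i), this, add_zero, mul_zero]
    · refine mul_nonpos_of_nonpos_of_nonneg (hA i j hij) ?_
      have hpos := posPart_nonneg n
      have hneg := negPart_nonneg n
      exact add_nonneg (mul_nonneg (hpos i) (hneg j)) (mul_nonneg (hneg i) (hpos j))
  rw [hsplit i, hsplit j]
  linarith

theorem nonneg_or_nonpos_of_form_eq_two {A : Matrix ι ι ℤ} (hA : ∀ i j, i ≠ j → A i j ≤ 0)
    (hnonneg : ∀ n, 0 ≤ n ⬝ᵥ A *ᵥ n) (heven : ∀ n, Even (n ⬝ᵥ A *ᵥ n))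
    (hnull : ∀ n, n ⬝ᵥ A *ᵥ n = 0 → n = 0 ∨ ∀ i, n i ≠ 0)
    {n : ι → ℤ} (hn : n ⬝ᵥ A *ᵥ n = 2) : 0 ≤ n ∨ n ≤ 0 := by
  have hle := posPart_form_add_negPart_form_le hA n
  have hzero : n⁺ ⬝ᵥ A *ᵥ n⁺ = 0 ∨ n⁻ ⬝ᵥ A *ᵥ n⁻ = 0 := by
    obtain ⟨p, hp⟩ := heven n⁺
    obtain ⟨q, hq⟩ := heven n⁻
    have := hnonneg n⁺
    have := hnonneg n⁻
    omega
  rcases hzero with h | h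
  · rcases hnull _ h with h0 | h0
    · exact .inr (posPart_eq_zero.1 h0)
    · exact .inl fun i => (posPart_pos_iff.1 ((posPart_nonneg n i).lt_of_ne' (h0 i))).le
  · rcases hnull _ h with h0 | h0
    · exact .inl (negPart_eq_zero.1 h0)
    · exact .inr fun i => (negPart_pos_iff.1 ((negPart_nonneg n i).lt_of_ne' (h0 i))).le

theorem exists_eq_single_of_sum_eq_one [DecidableEq ι] {n : ι → ℤ} (hn : 0 ≤ n)
    (hsum : ∑ i, n i = 1) : ∃ i, n = Pi.single i 1 := by
  obtain ⟨i, -, hi⟩ : ∃ i ∈ Finset.univ, 0 < n i :=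
    Finset.exists_lt_of_sum_lt (by simp [hsum])
  have hrest : ∑ j ∈ Finset.univ.erase i, n j = 0 := by
    have := Finset.add_sum_erase Finset.univ n (Finset.mem_univ i)
    have := Finset.sum_nonneg fun j (_ : j ∈ Finset.univ.erase i) => hn j
    omega
  have hzero := (Finset.sum_eq_zero_iff_of_nonneg fun j _ => hn j).1 hrest
  refine ⟨i, funext fun j => ?_⟩
  rcases eq_or_ne j i with rfl | hj
  · have := Finset.add_sum_erase Finset.univ n (Finset.mem_univ j)
    simpa [hrest, hsum] using this
  · simpa [hj] using hzero j (by simp [hj])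

end CartanMatrix

section FormD6

open Matrix

/-- The marks of the affine diagram `D₆⁽¹⁾`: the positive null vector of the Cartan matrix. -/
def marks : RootLatticeD6 := ![1, 1, 2, 2, 2, 1, 1]

theorem marks_pos (i : Fin 7) : 0 < marks i := by revert i; decide

theorem two_mul_cartanD6_form (n : RootLatticeD6) : 2 * (n ⬝ᵥ cartanD6 *ᵥ n) =
    (2 * n 0 - n 2) ^ 2 + (2 * n 1 - n 2) ^ 2 + 2 * (n 2 - n 3) ^ 2 + 2 * (n 3 - n 4) ^ 2 +
      (2 * n 5 - n 4) ^ 2 + (2 * n 6 - n 4) ^ 2 := by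
  simp only [dotProduct, mulVec, cartanD6, of_apply, Fin.sum_univ_seven, cons_val]
  ring

theorem cartanD6_form_nonneg (n : RootLatticeD6) : 0 ≤ n ⬝ᵥ cartanD6 *ᵥ n := by
  have := two_mul_cartanD6_form n
  have : 0 ≤ 2 * (n ⬝ᵥ cartanD6 *ᵥ n) := by rw [this]; positivity
  omega

theorem even_cartanD6_form (n : RootLatticeD6) : Even (n ⬝ᵥ cartanD6 *ᵥ n) := by
  refine ⟨n 0 ^ 2 + n 1 ^ 2 + n 2 ^ 2 + n 3 ^ 2 + n 4 ^ 2 + n 5 ^ 2 + n 6 ^ 2 - n 0 * n 2 -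
    n 1 * n 2 - n 2 * n 3 - n 3 * n 4 - n 4 * n 5 - n 4 * n 6, ?_⟩
  linarith [two_mul_cartanD6_form n]

theorem eq_smul_marks_of_cartanD6_form_eq_zero {n : RootLatticeD6}
    (hn : n ⬝ᵥ cartanD6 *ᵥ n = 0) : n = n 0 • marks := by
  have h := two_mul_cartanD6_form n
  rw [hn] at h
  have h02 : 2 * n 0 - n 2 = 0 := by nlinarith
  have h12 : 2 * n 1 - n 2 = 0 := by nlinarith
  have h23 : n 2 - n 3 = 0 := by nlinarith
  have h34 : n 3 - n 4 = 0 := by nlinarith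
  have h54 : 2 * n 5 - n 4 = 0 := by nlinarith
  have h64 : 2 * n 6 - n 4 = 0 := by nlinarith
  funext i
  fin_cases i <;> simp [marks] <;> omega

theorem cartanD6_nonpos_of_ne {i j : Fin 7} (hij : i ≠ j) : cartanD6 i j ≤ 0 :=
  neg_nonneg.1 (by revert i j; decide)

theorem cartanD6_root_nonneg_or_nonpos {n : RootLatticeD6} (hn : n ⬝ᵥ cartanD6 *ᵥ n = 2) :
    0 ≤ n ∨ n ≤ 0 := by
  refine nonneg_or_nonpos_of_form_eq_two (fun _ _ => cartanD6_nonpos_of_ne)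
    cartanD6_form_nonneg even_cartanD6_form (fun m hm => ?_) hn
  have hmarks := eq_smul_marks_of_cartanD6_form_eq_zero hm
  rcases eq_or_ne (m 0) 0 with h0 | h0
  · exact .inl (by rw [hmarks, h0, zero_smul])
  · refine .inr fun i => ?_
    rw [hmarks, Pi.smul_apply, smul_eq_mul]
    exact mul_ne_zero h0 (marks_pos i).ne'

end FormD6

section Intersection

theorem inter_apply (D F : Pic) : inter D F = D (.inl 0) * F (.inl 1) + D (.inl 1) * F (.inl 0)
    - ∑ k : Fin 8, D (.inr k) * F (.inr k) := rfl

theorem inter_comm (D F : Pic) : inter D F = inter F D := by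
  simp only [inter_apply, mul_comm (D _)]
  ring

theorem inter_Hx (D : Pic) : inter Hx D = D (.inl 1) := by
  simp [inter_apply, Hx]

theorem inter_Hy (D : Pic) : inter Hy D = D (.inl 0) := by
  simp [inter_apply, Hy]

theorem inter_E (k : Fin 8) (D : Pic) : inter (E k) D = -D (.inr k) := by
  simp [inter_apply, E, Pi.single_apply]

theorem inter_delta (D : Pic) :
    inter delta D = 2 * D (.inl 0) + 2 * D (.inl 1) + ∑ k : Fin 8, D (.inr k) := by
  simp only [delta, map_sub, map_add, map_smul, map_sum, LinearMap.sub_apply, LinearMap.add_apply,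
    LinearMap.smul_apply, LinearMap.sum_apply, inter_Hx, inter_Hy, inter_E, Finset.sum_neg_distrib,
    smul_eq_mul]
  ring

theorem inter_self_nonpos {D : Pic} (hD : inter delta D = 0) : inter D D ≤ 0 := by
  have hcs := Finset.sum_mul_sq_le_sq_mul_sq Finset.univ (fun _ : Fin 8 => 1)
    fun k => D (.inr k)
  rw [inter_delta] at hD
  have hsum : ∑ k, D (.inr k) = -2 * (D (.inl 0) + D (.inl 1)) := by linarith
  simp only [one_mul, hsum, one_pow, Finset.sum_const, Finset.card_univ, Fintype.card_fin,
    nsmul_eq_mul] at hcs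
  simp only [inter_apply, ← sq]
  push_cast at hcs
  nlinarith [sq_nonneg (D (.inl 0) - D (.inl 1))]

end Intersection

section RootLattice

open Matrix

/-- The class `𝓔₁ + 𝓔₂ - 𝓔₅ - 𝓔₆`, whose image under `ι^*` is the first constrained quantity. -/
def clsA : Pic := E 0 + E 1 - E 4 - E 5

/-- The class `𝓔₃ + 𝓔₄ - 𝓔₇ - 𝓔₈`, whose image under `ι^*` is the second constrained
quantity. -/
def clsB : Pic := E 2 + E 3 - E 6 - E 7

theorem inter_clsA (D : Pic) :
    inter clsA D = -D (.inr 0) - D (.inr 1) + D (.inr 4) + D (.inr 5) := by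
  simp only [clsA, map_sub, map_add, LinearMap.sub_apply, LinearMap.add_apply, inter_E]
  ring

theorem inter_clsB (D : Pic) :
    inter clsB D = -D (.inr 2) - D (.inr 3) + D (.inr 6) + D (.inr 7) := by
  simp only [clsB, map_sub, map_add, LinearMap.sub_apply, LinearMap.add_apply, inter_E]
  ring

theorem inter_beta (i j : Fin 7) : inter (beta i) (beta j) = -cartanD6 i j := by
  revert i j; decide

theorem inter_beta_delta (i : Fin 7) : inter (beta i) delta = 0 := by revert i; decide

theorem inter_beta_clsA (i : Fin 7) : inter (beta i) clsA = 0 := by revert i; decide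

theorem inter_beta_clsB (i : Fin 7) : inter (beta i) clsB = 0 := by revert i; decide

/-- The embedding of the abstract root lattice of type `D₆⁽¹⁾` in the Picard lattice that takes
the `i`-th simple root to `β_i`; its range is `Q_B`. -/
def rootMap : RootLatticeD6 →ₗ[ℤ] Pic := Fintype.linearCombination ℤ beta

theorem rootMap_single (i : Fin 7) : rootMap (Pi.single i 1) = beta i := by
  rw [rootMap, Fintype.linearCombination_apply_single, one_smul]

theorem inter_rootMap_left (n : RootLatticeD6) (D : Pic) :
    inter (rootMap n) D = ∑ i, n i * inter (beta i) D := by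
  simp only [rootMap, Fintype.linearCombination_apply, map_sum, map_smul, LinearMap.sum_apply,
    LinearMap.smul_apply, smul_eq_mul]

theorem inter_beta_rootMap (i : Fin 7) (n : RootLatticeD6) :
    inter (beta i) (rootMap n) = -(cartanD6 *ᵥ n) i := by
  rw [inter_comm, inter_rootMap_left]
  simp only [inter_comm _ (beta i), inter_beta, mulVec, dotProduct, mul_comm (n _),
    neg_mul, Finset.sum_neg_distrib]

theorem inter_rootMap (m n : RootLatticeD6) :
    inter (rootMap m) (rootMap n) = -(m ⬝ᵥ cartanD6 *ᵥ n) := by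
  simp only [inter_rootMap_left, inter_beta_rootMap, dotProduct, mul_neg, Finset.sum_neg_distrib]

theorem rootMap_apply (n : RootLatticeD6) : rootMap n = Sum.elim ![n 3, n 2 + n 4 - n 3]
    ![n 0 - n 2, -n 0, n 5 - n 4, -n 5, n 1 - n 2, -n 1, n 6 - n 4, -n 6] := by
  funext i
  rcases i with i | k
  · fin_cases i <;>
      simp [rootMap, Fintype.linearCombination_apply, Fin.sum_univ_seven, beta, Hx, Hy, E]
    ring
  · fin_cases k <;>
      simp [rootMap, Fintype.linearCombination_apply, Fin.sum_univ_seven, beta, Hx, Hy, E] <;> ring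

theorem rootMap_injective : Function.Injective rootMap := by
  rw [← LinearMap.ker_eq_bot, LinearMap.ker_eq_bot']
  intro n hn
  rw [rootMap_apply] at hn
  simp only [funext_iff, Pi.zero_apply, Sum.forall, Sum.elim_inl, Fin.forall_fin_succ,
    cons_val_zero, cons_val_succ, cons_val_fin_one, forall_const, Sum.elim_inr] at hn
  funext i
  fin_cases i <;> simp <;> omega

theorem linearIndependent_beta : LinearIndependent ℤ beta :=
  linearIndependent_iff_injective_fintypeLinearCombination.2 rootMap_injective

theorem rootMap_marks : rootMap marks = delta := by decide

theorem mem_range_rootMap_iff {D : Pic} : D ∈ LinearMap.range rootMap ↔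
    inter delta D = 0 ∧ inter clsA D = 0 ∧ inter clsB D = 0 := by
  constructor
  · rintro ⟨n, rfl⟩
    simp only [inter_comm _ (rootMap n), inter_rootMap_left, inter_beta_delta, inter_beta_clsA,
      inter_beta_clsB, mul_zero, Finset.sum_const_zero, and_self]
  · rintro ⟨hδ, hA, hB⟩
    refine ⟨![-D (.inr 1), -D (.inr 5), -D (.inr 0) - D (.inr 1), D (.inl 0),
      -D (.inr 2) - D (.inr 3), -D (.inr 3), -D (.inr 7)], ?_⟩
    simp only [inter_delta, inter_clsA, inter_clsB, Fin.sum_univ_eight] at hδ hA hB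
    rw [rootMap_apply, ← Sum.elim_comp_inl_inr D]
    congr 1
    · funext i
      fin_cases i <;> simp
      omega
    · funext k
      fin_cases k <;> simp <;> omega

theorem eq_zsmul_delta_of_orthogonal {D : Pic} (hA : inter clsA D = 0) (hB : inter clsB D = 0)
    (hβ : ∀ i, inter (beta i) D = 0) : ∃ k : ℤ, D = k • delta := by
  have hδ : inter delta D = 0 := by
    rw [← rootMap_marks, inter_rootMap_left]
    simp only [hβ, mul_zero, Finset.sum_const_zero]
  obtain ⟨n, rfl⟩ := mem_range_rootMap_iff.2 ⟨hδ, hA, hB⟩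
  have hn : n ⬝ᵥ cartanD6 *ᵥ n = 0 := by
    rw [← neg_eq_zero, ← inter_rootMap, inter_rootMap_left]
    simp only [hβ, mul_zero, Finset.sum_const_zero]
  refine ⟨n 0, ?_⟩
  conv_lhs => rw [eq_smul_marks_of_cartanD6_form_eq_zero hn]
  rw [map_smul, rootMap_marks]

end RootLattice

section Automorphisms

variable {R M : Type*} [Semiring R] [AddCommMonoid M] [Module R M]

theorem apply_inv_self (g : M ≃ₗ[R] M) (v : M) : g (g⁻¹ v) = v := g.apply_symm_apply v

theorem inv_apply_self (g : M ≃ₗ[R] M) (v : M) : g⁻¹ (g v) = v := g.symm_apply_apply v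

end Automorphisms

section Isometries

/-- The isometries of the Picard lattice that fix `δ`. -/
def isometries : Subgroup (Pic ≃ₗ[ℤ] Pic) where
  carrier := {g | (∀ D F, inter (g D) (g F) = inter D F) ∧ g delta = delta}
  one_mem' := ⟨fun _ _ => rfl, rfl⟩
  mul_mem' := by
    rintro g h ⟨hg, hgδ⟩ ⟨hh, hhδ⟩
    exact ⟨fun D F => by rw [LinearEquiv.mul_apply, LinearEquiv.mul_apply, hg, hh],
      by rw [LinearEquiv.mul_apply, hhδ, hgδ]⟩
  inv_mem' := by
    rintro g ⟨hg, hgδ⟩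
    exact ⟨fun D F => by rw [← hg (g⁻¹ D), apply_inv_self, apply_inv_self],
      by rw [← hgδ, inv_apply_self, hgδ]⟩

theorem inter_inv_apply {g : Pic ≃ₗ[ℤ] Pic} (hg : g ∈ isometries) (D F : Pic) :
    inter (g⁻¹ D) F = inter D (g F) := by
  rw [← hg.1, apply_inv_self]

theorem inter_apply_of_apply_eq {g : Pic ≃ₗ[ℤ] Pic} (hg : g ∈ isometries) {F : Pic}
    (hF : g F = F) (D : Pic) : inter F (g D) = inter F D := by
  conv_lhs => rw [← hF, hg.1]

theorem refl_mem_isometries {a : Pic} (ha : inter a a = -2) (hδ : inter a delta = 0) :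
    refl a ha ∈ isometries := by
  refine ⟨fun D F => ?_, by rw [refl_apply, hδ, zero_smul, add_zero]⟩
  simp only [refl_apply, map_add, map_smul, LinearMap.add_apply, LinearMap.smul_apply, smul_eq_mul,
    ha, inter_comm D a]
  ring

theorem refl_conj {g : Pic ≃ₗ[ℤ] Pic} (hg : g ∈ isometries) {a b : Pic} (ha : inter a a = -2)
    (hb : inter b b = -2) (hab : g a = b) : g * refl a ha * g⁻¹ = refl b hb := by
  refine LinearEquiv.ext fun D => ?_
  rw [LinearEquiv.mul_apply, LinearEquiv.mul_apply, refl_apply, refl_apply, map_add, map_smul,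
    apply_inv_self, hab, inter_comm, inter_inv_apply hg, hab, inter_comm]

theorem wBeta_apply (i : Fin 7) (D : Pic) : wBeta i D = D + inter (beta i) D • beta i :=
  refl_apply _ _ D

theorem wBeta_mem_isometries (i : Fin 7) : wBeta i ∈ isometries :=
  refl_mem_isometries (beta_sq i) (inter_beta_delta i)

theorem weylE8_le_isometries : weylE8 ≤ isometries := by
  rw [weylE8, Subgroup.closure_le]
  rintro _ ⟨i, rfl⟩
  exact refl_mem_isometries (alpha_sq i) (by revert i; decide)

/-- The isometries of the Picard lattice that fix `δ` and both constraint classes. -/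
def constraintFixer : Subgroup (Pic ≃ₗ[ℤ] Pic) :=
  isometries ⊓ fixingSubgroup (Pic ≃ₗ[ℤ] Pic) {clsA, clsB}

theorem mem_constraintFixer_iff {g : Pic ≃ₗ[ℤ] Pic} :
    g ∈ constraintFixer ↔ g ∈ isometries ∧ g clsA = clsA ∧ g clsB = clsB := by
  simp [constraintFixer, mem_fixingSubgroup_iff]

theorem apply_mem_range_rootMap {g : Pic ≃ₗ[ℤ] Pic} (hg : g ∈ constraintFixer) {D : Pic}
    (hD : D ∈ LinearMap.range rootMap) : g D ∈ LinearMap.range rootMap := by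
  obtain ⟨hg, hA, hB⟩ := mem_constraintFixer_iff.1 hg
  rw [mem_range_rootMap_iff] at hD ⊢
  rwa [inter_apply_of_apply_eq hg hg.2, inter_apply_of_apply_eq hg hA,
    inter_apply_of_apply_eq hg hB]

/-- The group generated by the reflections in `β₀, …, β₆`. -/
def reflectionsB : Subgroup (Pic ≃ₗ[ℤ] Pic) := Subgroup.closure (Set.range wBeta)

theorem wBeta_mem_reflectionsB (i : Fin 7) : wBeta i ∈ reflectionsB :=
  Subgroup.subset_closure ⟨i, rfl⟩

theorem reflectionsB_le_constraintFixer : reflectionsB ≤ constraintFixer := by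
  rw [reflectionsB, Subgroup.closure_le]
  rintro _ ⟨i, rfl⟩
  refine mem_constraintFixer_iff.2 ⟨wBeta_mem_isometries i, ?_, ?_⟩
  · rw [wBeta_apply, inter_beta_clsA, zero_smul, add_zero]
  · rw [wBeta_apply, inter_beta_clsB, zero_smul, add_zero]

end Isometries

section Chamber

/-- The class of height one at every `β_i`: `β_i • ρ = 1`. -/
def rho : Pic := Hy + E 1 + E 3 + E 4 + (2 : ℤ) • E 5 + E 6 + (2 : ℤ) • E 7

theorem inter_beta_rho (i : Fin 7) : inter (beta i) rho = 1 := by revert i; decide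

theorem inter_rootMap_rho (n : RootLatticeD6) : inter (rootMap n) rho = ∑ i, n i := by
  simp only [inter_rootMap_left, inter_beta_rho, mul_one]

theorem inter_rho_self_le {D : Pic} (hsq : inter D D = inter rho rho)
    (hδ : inter delta D = inter delta rho) : inter rho rho ≤ inter rho D := by
  have h : inter (D - rho) (D - rho) ≤ 0 :=
    inter_self_nonpos (by rw [map_sub, hδ, sub_self])
  simp only [map_sub, LinearMap.sub_apply, hsq, inter_comm D rho] at h
  linarith

theorem exists_mem_reflectionsB_dominant {D : Pic} (hsq : inter D D = inter rho rho)
    (hδ : inter delta D = inter delta rho) :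
    ∃ w ∈ reflectionsB, ∀ i, 0 ≤ inter (beta i) (w D) := by
  induction h : (inter rho D - inter rho rho).toNat using Nat.strong_induction_on generalizing D
    with
  | _ k ih =>
    by_cases hdom : ∀ i, 0 ≤ inter (beta i) D
    · exact ⟨1, one_mem _, hdom⟩
    · push Not at hdom
      obtain ⟨i, hi⟩ := hdom
      have hsq' : inter (wBeta i D) (wBeta i D) = inter rho rho := by
        rw [(wBeta_mem_isometries i).1, hsq]
      have hδ' : inter delta (wBeta i D) = inter delta rho := by
        rw [inter_apply_of_apply_eq (wBeta_mem_isometries i) (wBeta_mem_isometries i).2, hδ]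
      have hdrop : inter rho (wBeta i D) = inter rho D + inter (beta i) D := by
        rw [wBeta_apply, map_add, map_smul, inter_comm rho (beta i), inter_beta_rho, smul_eq_mul,
          mul_one]
      have := inter_rho_self_le hsq' hδ'
      obtain ⟨w, hw, hdomw⟩ := ih _ (by omega) hsq' hδ' rfl
      exact ⟨w * wBeta i, mul_mem hw (wBeta_mem_reflectionsB i), hdomw⟩

theorem nonneg_and_sum_pos_of_root {n : RootLatticeD6}
    (hroot : inter (rootMap n) (rootMap n) = -2) (hsum : 0 ≤ ∑ i, n i) :
    0 ≤ n ∧ 0 < ∑ i, n i := by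
  have hn0 : n ≠ 0 := by
    rintro rfl
    simp at hroot
  rw [inter_rootMap, neg_inj] at hroot
  rcases cartanD6_root_nonneg_or_nonpos hroot with h | h
  · exact ⟨h, Fintype.sum_pos (h.lt_of_ne' hn0)⟩
  · exact absurd hsum (Fintype.sum_neg (h.lt_of_ne hn0)).not_ge

/-- The heights of the `g β_i` are positive and, weighted by the marks, add up to `δ • ρ`, just
as for the `β_i` themselves; so each of them is `1`. -/
theorem exists_apply_beta_eq {g : Pic ≃ₗ[ℤ] Pic} (hg : g ∈ constraintFixer)
    (hdom : ∀ i, 0 ≤ inter (g (beta i)) rho) :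
    ∃ f : Fin 7 → Fin 7, ∀ i, g (beta i) = beta (f i) := by
  have hiso := (mem_constraintFixer_iff.1 hg).1
  choose n hn using fun i => apply_mem_range_rootMap hg ⟨_, rootMap_single i⟩
  have hroot (i : Fin 7) : 0 ≤ n i ∧ 0 < ∑ j, n i j := by
    refine nonneg_and_sum_pos_of_root ?_ ?_
    · rw [hn, hiso.1, beta_sq]
    · rw [← inter_rootMap_rho, hn]
      exact hdom i
  have htotal : ∑ i, marks i * ∑ j, n i j = ∑ i, marks i := by
    have hδ : inter (g (rootMap marks)) rho = inter (rootMap marks) rho := by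
      rw [rootMap_marks, hiso.2]
    simpa only [rootMap, Fintype.linearCombination_apply, map_sum, map_smul, LinearMap.sum_apply,
      LinearMap.smul_apply, smul_eq_mul, ← hn, inter_beta_rho, mul_one, inter_rootMap_rho] using hδ
  have hone (i : Fin 7) : ∑ j, n i j = 1 := by
    have heq := (Finset.sum_eq_sum_iff_of_le fun i _ =>
      le_mul_of_one_le_right (marks_pos i).le (hroot i).2).1 htotal.symm i (Finset.mem_univ i)
    exact (mul_eq_left₀ (marks_pos i).ne').1 heq.symm
  choose f hf using fun i => exists_eq_single_of_sum_eq_one (hroot i).1 (hone i)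
  exact ⟨f, fun i => by rw [← hn, hf, rootMap_single]⟩

end Chamber

section Rigidity

open Matrix

/-- The four leaves have different classes in the cokernel of the Cartan matrix, so a nontrivial
diagram automorphism cannot act trivially on that cokernel. -/
theorem eq_of_cartanD6_mulVec_eq {i j : Fin 7} {n : RootLatticeD6} (hi : marks i = 1)
    (h : cartanD6 *ᵥ n = Pi.single i 1 - Pi.single j 1) : i = j := by
  have hmarks : marks ⬝ᵥ cartanD6 *ᵥ n = 0 := by
    have : marks ᵥ* cartanD6 = 0 := by decide
    rw [dotProduct_mulVec, this, zero_dotProduct]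
  have h01 : (cartanD6 *ᵥ n) 0 + (cartanD6 *ᵥ n) 1 = 2 * (n 0 + n 1 - n 2) := by
    simp only [mulVec, dotProduct, cartanD6, of_apply, Fin.sum_univ_seven, cons_val]
    ring
  have h035 : (cartanD6 *ᵥ n) 0 + (cartanD6 *ᵥ n) 3 + (cartanD6 *ᵥ n) 5 =
      2 * (n 0 + n 3 + n 5 - n 2 - n 4) := by
    simp only [mulVec, dotProduct, cartanD6, of_apply, Fin.sum_univ_seven, cons_val]
    ring
  rw [h] at hmarks h01 h035
  rw [dotProduct_sub, dotProduct_single_one, dotProduct_single_one, hi] at hmarks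
  simp only [Pi.sub_apply, Pi.single_apply] at h01 h035
  fin_cases i <;> fin_cases j <;> simp [marks] at * <;> omega

theorem eq_of_cartanD6_leaf_eq {j k : Fin 7}
    (h : ∀ i, marks i = 1 → cartanD6 j i = cartanD6 k i) : j = k := by
  revert h
  fin_cases j <;> fin_cases k <;> decide

theorem exists_inter_beta_eq_single {i : Fin 7} (hi : marks i = 1) :
    ∃ D : Pic, ∀ j, inter (beta j) D = (Pi.single i 1 : RootLatticeD6) j := by
  fin_cases i
  exacts [⟨E 1, by decide⟩, ⟨E 5, by decide⟩, absurd hi (by decide), absurd hi (by decide),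
    absurd hi (by decide), ⟨E 3, by decide⟩, ⟨E 7, by decide⟩]

theorem perm_eq_one_of_apply_beta {g : Pic ≃ₗ[ℤ] Pic} (hg : g ∈ constraintFixer)
    {π : Equiv.Perm (Fin 7)} (hπ : ∀ i, g (beta i) = beta (π i)) : π = 1 := by
  obtain ⟨hiso, hA, hB⟩ := mem_constraintFixer_iff.1 hg
  have hleaf (i : Fin 7) (hi : marks i = 1) : π i = i := by
    obtain ⟨D, hD⟩ := exists_inter_beta_eq_single hi
    obtain ⟨n, hn⟩ : g D - D ∈ LinearMap.range rootMap := by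
      simp only [mem_range_rootMap_iff, map_sub, inter_apply_of_apply_eq hiso hiso.2,
        inter_apply_of_apply_eq hiso hA, inter_apply_of_apply_eq hiso hB, sub_self, and_self]
    refine (eq_of_cartanD6_mulVec_eq hi (n := n) (funext fun k => ?_)).symm
    have hk : g (beta (π.symm k)) = beta k := by rw [hπ, Equiv.apply_symm_apply]
    have hgD : inter (beta k) (g D) = (Pi.single (π i) 1 : RootLatticeD6) k := by
      rw [← hk, hiso.1, hD]
      simp only [Pi.single_apply, Equiv.symm_apply_eq]
    rw [← neg_inj, ← inter_beta_rootMap, hn, map_sub, hgD, hD, Pi.sub_apply, neg_sub]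
  refine Equiv.ext fun j => eq_of_cartanD6_leaf_eq fun i hi => ?_
  rw [Equiv.Perm.one_apply, ← neg_inj, ← inter_beta, ← inter_beta]
  conv_lhs => rw [← hleaf i hi, ← hπ, ← hπ, hiso.1]

theorem eq_one_of_apply_beta {g : Pic ≃ₗ[ℤ] Pic} (hg : g ∈ constraintFixer)
    (hβ : ∀ i, g (beta i) = beta i) : g = 1 := by
  obtain ⟨hiso, hA, hB⟩ := mem_constraintFixer_iff.1 hg
  have hshift (D : Pic) : ∃ k : ℤ, g D = D + k • delta := by
    obtain ⟨k, hk⟩ : ∃ k : ℤ, g D - D = k • delta := by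
      refine eq_zsmul_delta_of_orthogonal ?_ ?_ fun i => ?_ <;> rw [map_sub, sub_eq_zero]
      exacts [inter_apply_of_apply_eq hiso hA D, inter_apply_of_apply_eq hiso hB D,
        inter_apply_of_apply_eq hiso (hβ i) D]
    exact ⟨k, by rw [← hk, add_sub_cancel]⟩
  have hδδ : inter delta delta = 0 := by decide
  have hEδ : inter (E 0) delta = 1 := by decide
  have hE : g (E 0) = E 0 := by
    obtain ⟨k, hk⟩ := hshift (E 0)
    have hsq := hiso.1 (E 0) (E 0)
    simp only [hk, map_add, map_smul, LinearMap.add_apply, LinearMap.smul_apply, smul_eq_mul, hδδ,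
      inter_comm delta (E 0), hEδ] at hsq
    rw [hk, show k = 0 by omega, zero_smul, add_zero]
  refine LinearEquiv.ext fun D => ?_
  obtain ⟨k, hk⟩ := hshift D
  have hinter := inter_apply_of_apply_eq hiso hE D
  rw [hk, map_add, map_smul, hEδ, smul_eq_mul] at hinter
  rw [hk, show k = 0 by omega, zero_smul, add_zero, LinearEquiv.coe_one, id]

theorem constraintFixer_eq_reflectionsB : constraintFixer = reflectionsB := by
  refine le_antisymm (fun g hg => ?_) reflectionsB_le_constraintFixer
  have hiso := (mem_constraintFixer_iff.1 hg).1
  obtain ⟨w, hw, hdom⟩ := exists_mem_reflectionsB_dominant (D := g rho) (hiso.1 rho rho)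
    (inter_apply_of_apply_eq hiso hiso.2 rho)
  have hwg : (w * g)⁻¹ ∈ constraintFixer :=
    inv_mem (mul_mem (reflectionsB_le_constraintFixer hw) hg)
  have hwg' := (mem_constraintFixer_iff.1 hwg).1
  obtain ⟨f, hf⟩ := exists_apply_beta_eq hwg fun i => by
    rw [inter_inv_apply (inv_mem_iff.1 hwg')]
    exact hdom i
  have hinj : Function.Injective f := fun i j hij => linearIndependent_beta.injective <|
    (w * g)⁻¹.injective (by rw [hf, hf, hij])
  have hone := perm_eq_one_of_apply_beta hwg
    (π := .ofBijective f (Finite.injective_iff_bijective.1 hinj)) hf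
  have : w * g = 1 := inv_eq_one.1 <| eq_one_of_apply_beta hwg fun i => by
    rw [hf]
    exact congrArg beta (Equiv.congr_fun hone i)
  rw [eq_inv_of_mul_eq_one_right this]
  exact inv_mem hw

end Rigidity

section WeylE8

theorem equiv_ext {v w : Pic ≃ₗ[ℤ] Pic} (h : ∀ i, v (Pi.single i 1) = w (Pi.single i 1)) :
    v = w :=
  LinearEquiv.toLinearMap_injective <| (Pi.basisFun ℤ (Fin 2 ⊕ Fin 8)).ext fun i => by
    simpa only [Pi.basisFun_apply, LinearEquiv.coe_coe] using h i

theorem permE_mul (π ρ : Equiv.Perm (Fin 8)) : permE (π * ρ) = permE π * permE ρ :=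
  LinearEquiv.ext fun _ => funext <| Sum.rec (fun _ => rfl) fun _ => rfl

theorem permE_one : permE 1 = 1 :=
  LinearEquiv.ext fun _ => funext <| Sum.rec (fun _ => rfl) fun _ => rfl

theorem permE_swap_eq_refl (i : Fin 7) : permE (.swap i.castSucc i.succ) =
    refl (alpha (![0, 3, 4, 5, 6, 7, 8] i)) (alpha_sq _) :=
  equiv_ext (by revert i; decide)

theorem refl_alpha_mem_weylE8 (i : Fin 9) : refl (alpha i) (alpha_sq i) ∈ weylE8 :=
  Subgroup.subset_closure ⟨i, rfl⟩

theorem permE_mem_weylE8 (π : Equiv.Perm (Fin 8)) : permE π ∈ weylE8 := by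
  have hπ : π ∈ Submonoid.closure (Set.range fun i : Fin 7 => Equiv.swap i.castSucc i.succ) := by
    rw [Equiv.Perm.mclosure_swap_castSucc_succ]
    exact Submonoid.mem_top π
  induction hπ using Submonoid.closure_induction with
  | mem _ h =>
    obtain ⟨i, rfl⟩ := h
    rw [permE_swap_eq_refl]
    exact refl_alpha_mem_weylE8 _
  | one =>
    rw [permE_one]
    exact one_mem _
  | mul π ρ _ _ hπ hρ =>
    rw [permE_mul]
    exact mul_mem hπ hρ

theorem sigma1_mem_weylE8 : sigma1 ∈ weylE8 := permE_mem_weylE8 _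

theorem sigma2_mem_weylE8 : sigma2 ∈ weylE8 := permE_mem_weylE8 _

theorem exists_permE_alpha_eq_beta (i : Fin 7) : ∃ π j, permE π (alpha j) = beta i := by
  fin_cases i
  exacts [⟨1, 0, by decide⟩, ⟨1, 6, by decide⟩, ⟨.swap 1 4, 2, by decide⟩,
    ⟨1, 1, by decide⟩, ⟨.swap 0 2 * .swap 1 6, 2, by decide⟩, ⟨1, 4, by decide⟩,
    ⟨1, 8, by decide⟩]

theorem wBeta_mem_weylE8 (i : Fin 7) : wBeta i ∈ weylE8 := by
  obtain ⟨π, j, hj⟩ := exists_permE_alpha_eq_beta i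
  have hπ := permE_mem_weylE8 π
  rw [wBeta, ← refl_conj (weylE8_le_isometries hπ) (alpha_sq j) (beta_sq i) hj]
  exact mul_mem (mul_mem hπ (refl_alpha_mem_weylE8 j)) (inv_mem hπ)

end WeylE8

section ConstraintLattice

/-- The lattice of the classes that the constraint forces `ι^*` to kill. -/
def constraintLattice : Submodule ℤ Pic := Submodule.span ℤ {clsA, clsB}

theorem mem_constraintLattice_iff {D : Pic} :
    D ∈ constraintLattice ↔ ∃ m n : ℤ, m • clsA + n • clsB = D :=
  Submodule.mem_span_pair

theorem inter_clsA_clsA : inter clsA clsA = -4 := by decide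

theorem inter_clsA_clsB : inter clsA clsB = 0 := by decide

theorem inter_clsB_clsB : inter clsB clsB = -4 := by decide

theorem inter_smul_add_smul (k l m n : ℤ) :
    inter (k • clsA + l • clsB) (m • clsA + n • clsB) = -4 * (k * m + l * n) := by
  simp only [map_add, map_smul, LinearMap.add_apply, LinearMap.smul_apply, smul_eq_mul,
    inter_clsA_clsA, inter_clsA_clsB, inter_clsB_clsB, inter_comm clsB clsA]
  ring

theorem sigma1_clsA : sigma1 clsA = clsB := by decide

theorem sigma1_clsB : sigma1 clsB = -clsA := by decide

theorem sigma2_clsA : sigma2 clsA = -clsA := by decide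

theorem sigma2_clsB : sigma2 clsB = clsB := by decide

theorem sigma1_pow_apply_mem_constraintLattice (j : ℕ) {D : Pic} (hD : D ∈ constraintLattice) :
    (sigma1 ^ j) D ∈ constraintLattice := by
  induction j with
  | zero => exact hD
  | succ j ih =>
    obtain ⟨m, n, h⟩ := mem_constraintLattice_iff.1 ih
    refine mem_constraintLattice_iff.2 ⟨-n, m, ?_⟩
    rw [pow_succ', LinearEquiv.mul_apply, ← h, map_add, map_smul, map_smul, sigma1_clsA,
      sigma1_clsB, smul_neg, neg_smul, add_comm]

theorem exists_sigma1_pow_apply_eq_clsA {D : Pic} (hD : D ∈ constraintLattice)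
    (hsq : inter D D = -4) : ∃ j : ℕ, (sigma1 ^ j) D = clsA := by
  obtain ⟨m, n, rfl⟩ := mem_constraintLattice_iff.1 hD
  have hmn : m ^ 2 + n ^ 2 = 1 := by
    rw [inter_smul_add_smul] at hsq
    linarith
  have hm : m ∈ Set.Icc (-1) 1 := abs_le.1 ((sq_le_one_iff_abs_le_one _).1 (by nlinarith))
  have hn : n ∈ Set.Icc (-1) 1 := abs_le.1 ((sq_le_one_iff_abs_le_one _).1 (by nlinarith))
  obtain ⟨rfl, rfl⟩ | ⟨rfl, rfl⟩ | ⟨rfl, rfl⟩ | ⟨rfl, rfl⟩ : m = 1 ∧ n = 0 ∨ m = 0 ∧ n = -1 ∨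
      m = -1 ∧ n = 0 ∨ m = 0 ∧ n = 1 := by
    obtain ⟨hm1, hm2⟩ := hm
    obtain ⟨hn1, hn2⟩ := hn
    interval_cases m <;> interval_cases n <;> simp_all
  exacts [⟨0, by decide⟩, ⟨1, by decide⟩, ⟨2, by decide⟩, ⟨3, by decide⟩]

theorem eq_or_eq_neg_clsB {D : Pic} (hD : D ∈ constraintLattice) (hsq : inter D D = -4)
    (horth : inter clsA D = 0) : D = clsB ∨ D = -clsB := by
  obtain ⟨m, n, rfl⟩ := mem_constraintLattice_iff.1 hD
  have hm := inter_smul_add_smul 1 0 m n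
  rw [one_smul, zero_smul, add_zero, horth] at hm
  obtain rfl : m = 0 := by linarith
  rw [inter_smul_add_smul] at hsq
  rcases sq_eq_one_iff.1 (show n ^ 2 = 1 by linarith) with rfl | rfl
  · exact .inl (by simp)
  · exact .inr (by simp)

/-- Up to the factor `4`, the orthogonal projection of `D` to `Q_B` along `ℤA + ℤB`. -/
theorem four_smul_add_mem_range_rootMap {D : Pic} (hδ : inter delta D = 0) :
    (4 : ℤ) • D + inter clsA D • clsA + inter clsB D • clsB ∈ LinearMap.range rootMap := by
  have hδA : inter delta clsA = 0 := by decide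
  have hδB : inter delta clsB = 0 := by decide
  simp only [mem_range_rootMap_iff, map_add, map_smul, hδ, hδA, hδB, inter_clsA_clsA,
    inter_clsA_clsB, inter_clsB_clsB, inter_comm clsB clsA, smul_eq_mul]
  refine ⟨?_, ?_, ?_⟩ <;> ring

theorem mem_constraintLattice_of_four_smul_add_eq_zero {D : Pic}
    (hD : (4 : ℤ) • D + inter clsA D • clsA + inter clsB D • clsB = 0) :
    D ∈ constraintLattice := by
  have hA0 : clsA (.inr 0) = 1 := by decide
  have hA2 : clsA (.inr 2) = 0 := by decide
  have hB0 : clsB (.inr 0) = 0 := by decide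
  have hB2 : clsB (.inr 2) = 1 := by decide
  have h0 := congrFun hD (.inr 0)
  have h2 := congrFun hD (.inr 2)
  simp only [Pi.zero_apply, Pi.add_apply, Pi.smul_apply, smul_eq_mul, hA0, hA2, hB0, hB2] at h0 h2
  have hA : inter clsA D = -4 * D (.inr 0) := by linarith
  have hB : inter clsB D = -4 * D (.inr 2) := by linarith
  refine mem_constraintLattice_iff.2 ⟨D (.inr 0), D (.inr 2), ?_⟩
  refine smul_right_injective Pic (four_ne_zero (α := ℤ)) (Eq.symm ?_)
  rw [hA, hB] at hD
  linear_combination hD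

end ConstraintLattice

section ExtendedGroup

/-- The group generated by the reflections in `β₀, …, β₆` and by `σ₁, σ₂`. -/
def extendedReflectionsB : Subgroup (Pic ≃ₗ[ℤ] Pic) :=
  Subgroup.closure (Set.range wBeta ∪ {sigma1, sigma2})

theorem sigma1_mem_extendedReflectionsB : sigma1 ∈ extendedReflectionsB :=
  Subgroup.subset_closure (by simp)

theorem sigma2_mem_extendedReflectionsB : sigma2 ∈ extendedReflectionsB :=
  Subgroup.subset_closure (by simp)

theorem constraintFixer_le_extendedReflectionsB : constraintFixer ≤ extendedReflectionsB := by
  rw [constraintFixer_eq_reflectionsB]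
  exact Subgroup.closure_mono Set.subset_union_left

theorem extendedReflectionsB_le_weylE8 : extendedReflectionsB ≤ weylE8 := by
  rw [extendedReflectionsB, Subgroup.closure_le]
  rintro _ (⟨i, rfl⟩ | rfl | rfl)
  exacts [wBeta_mem_weylE8 i, sigma1_mem_weylE8, sigma2_mem_weylE8]

theorem exists_mul_mem_constraintFixer {g : Pic ≃ₗ[ℤ] Pic} (hg : g ∈ isometries)
    (hA : g clsA ∈ constraintLattice) (hB : g clsB ∈ constraintLattice) :
    ∃ s ∈ extendedReflectionsB, s * g ∈ constraintFixer := by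
  obtain ⟨j, hj⟩ := exists_sigma1_pow_apply_eq_clsA hA (by rw [hg.1]; decide)
  have hs := pow_mem sigma1_mem_extendedReflectionsB j
  have hs' := weylE8_le_isometries (extendedReflectionsB_le_weylE8 hs)
  have hflip := mul_mem (pow_mem sigma1_mem_extendedReflectionsB 2) sigma2_mem_extendedReflectionsB
  have hflip' := weylE8_le_isometries (extendedReflectionsB_le_weylE8 hflip)
  rcases eq_or_eq_neg_clsB (sigma1_pow_apply_mem_constraintLattice j hB)
    (by rw [hs'.1, hg.1]; decide) (by rw [← hj, hs'.1, hg.1]; decide) with h | h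
  · exact ⟨sigma1 ^ j, hs, mem_constraintFixer_iff.2 ⟨mul_mem hs' hg, hj, h⟩⟩
  · refine ⟨sigma1 ^ 2 * sigma2 * sigma1 ^ j, mul_mem hflip hs,
      mem_constraintFixer_iff.2 ⟨mul_mem (mul_mem hflip' hs') hg, ?_, ?_⟩⟩
    · rw [mul_assoc (sigma1 ^ 2 * sigma2), LinearEquiv.mul_apply, LinearEquiv.mul_apply _ g, hj]
      decide
    · rw [mul_assoc (sigma1 ^ 2 * sigma2), LinearEquiv.mul_apply, LinearEquiv.mul_apply _ g, h]
      decide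

theorem mem_extendedReflectionsB_of_apply_mem {g : Pic ≃ₗ[ℤ] Pic} (hg : g ∈ isometries)
    (hA : g clsA ∈ constraintLattice) (hB : g clsB ∈ constraintLattice) :
    g ∈ extendedReflectionsB := by
  obtain ⟨s, hs, hsg⟩ := exists_mul_mem_constraintFixer hg hA hB
  exact (mul_mem_cancel_left hs).1 (constraintFixer_le_extendedReflectionsB hsg)

end ExtendedGroup

section Constraint

variable {T : Type*} [AddCommGroup T] {p : Parameters T}

theorem Parameters.constraint_iff : p.Constraint ↔ p.pullback clsA = 0 ∧ p.pullback clsB = 0 := by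
  simp only [clsA, clsB, map_add, map_sub, pullback_E, Constraint]

theorem Parameters.constraint_evolve_iff {w : Pic ≃ₗ[ℤ] Pic} :
    (p.evolve w).Constraint ↔ p.pullback (w⁻¹ clsA) = 0 ∧ p.pullback (w⁻¹ clsB) = 0 := by
  rw [constraint_iff, pullback_evolve, pullback_evolve]

theorem extendedReflectionsB_le_preservingSubgroup (τ : ℂ) :
    extendedReflectionsB ≤ preservingSubgroup τ := by
  rw [extendedReflectionsB, Subgroup.closure_le]
  rintro w (⟨i, rfl⟩ | rfl | rfl)
  · have hw := reflectionsB_le_constraintFixer (inv_mem (wBeta_mem_reflectionsB i))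
    obtain ⟨-, hA, hB⟩ := mem_constraintFixer_iff.1 hw
    exact ⟨wBeta_mem_weylE8 i, fun p => by
      rw [Parameters.constraint_evolve_iff, Parameters.constraint_iff, hA, hB]⟩
  · refine ⟨sigma1_mem_weylE8, fun p => ?_⟩
    have hA : sigma1⁻¹ clsA = -clsB := by
      rw [← neg_eq_iff_eq_neg, ← map_neg, ← sigma1_clsB, inv_apply_self]
    have hB : sigma1⁻¹ clsB = clsA := by rw [← sigma1_clsA, inv_apply_self]
    rw [Parameters.constraint_evolve_iff, Parameters.constraint_iff, hA, hB, map_neg, neg_eq_zero,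
      and_comm]
  · refine ⟨sigma2_mem_weylE8, fun p => ?_⟩
    have hA : sigma2⁻¹ clsA = -clsA := by
      rw [← neg_eq_iff_eq_neg, ← map_neg, ← sigma2_clsA, inv_apply_self]
    have hB : sigma2⁻¹ clsB = clsB := by
      conv_lhs => rw [← sigma2_clsB, inv_apply_self]
    rw [Parameters.constraint_evolve_iff, Parameters.constraint_iff, hA, hB, map_neg, neg_eq_zero]

theorem mem_constraintLattice_of_pullback_eq_zero (hp : p.Constraint) (hgen : p.IsGeneric)
    {D : Pic} (hδ : inter delta D = 0) (hD : p.pullback D = 0) : D ∈ constraintLattice := by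
  obtain ⟨n, hn⟩ := four_smul_add_mem_range_rootMap hδ
  have hpull : ∑ i, n i • p.pullback (beta i) = 0 := by
    obtain ⟨hA, hB⟩ := Parameters.constraint_iff.1 hp
    simpa only [rootMap, Fintype.linearCombination_apply, map_sum, map_add, map_smul, hD, hA, hB,
      smul_zero, add_zero] using congrArg p.pullback hn
  obtain rfl : n = 0 := funext (Fintype.linearIndependent_iff.1 hgen n hpull)
  exact mem_constraintLattice_of_four_smul_add_eq_zero (hn.symm.trans (map_zero _))

theorem mem_extendedReflectionsB_of_isGeneric (hp : p.Constraint) (hgen : p.IsGeneric)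
    {w : Pic ≃ₗ[ℤ] Pic} (hw : w ∈ isometries) (h : (p.evolve w).Constraint) :
    w ∈ extendedReflectionsB := by
  rw [Parameters.constraint_evolve_iff] at h
  have hδ (D : Pic) (hD : inter delta D = 0) : inter delta (w⁻¹ D) = 0 := by
    rw [inter_apply_of_apply_eq (inv_mem hw) (inv_mem hw).2, hD]
  exact inv_mem_iff.1 <| mem_extendedReflectionsB_of_apply_mem (inv_mem hw)
    (mem_constraintLattice_of_pullback_eq_zero hp hgen (hδ _ (by decide)) h.1)
    (mem_constraintLattice_of_pullback_eq_zero hp hgen (hδ _ (by decide)) h.2)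

theorem mem_preservingSubgroup_of_isGeneric {τ : ℂ} {p : Parameters (Torus τ)} (hp : p.Constraint)
    (hgen : p.IsGeneric) {w : Pic ≃ₗ[ℤ] Pic} (hw : w ∈ weylE8) (h : (p.evolve w).Constraint) :
    w ∈ preservingSubgroup τ :=
  extendedReflectionsB_le_preservingSubgroup τ
    (mem_extendedReflectionsB_of_isGeneric hp hgen (weylE8_le_isometries hw) h)

end Constraint

section Generic

theorem exists_isGeneric_of_linearIndependent {T : Type*} [AddCommGroup T] {u : Fin 7 → T}
    (hu : LinearIndependent ℤ u) : ∃ p : Parameters T, p.Constraint ∧ p.IsGeneric := by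
  let p : Parameters T := ⟨u 3, u 2,
    ![u 0, -u 0, u 4 + u 5, u 4 - u 5, u 1, -u 1, u 4 + u 6, u 4 - u 6]⟩
  refine ⟨p, ⟨by simp [p], by simp [p]⟩, Fintype.linearIndependent_iff.2 fun c hc => ?_⟩
  let d : Fin 7 → ℤ := ![2 * c 0 - c 2, 2 * c 1 - c 2, c 2 - c 3 + c 4, c 3, -2 * c 4,
    2 * c 5 - c 4, 2 * c 6 - c 4]
  have hd : ∑ i, d i • u i = 0 := by
    rw [← hc]
    simp only [Fin.sum_univ_seven, beta, Matrix.cons_val, map_sub, Parameters.pullback_Hx,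
      Parameters.pullback_Hy, Parameters.pullback_E, p, d]
    module
  have h := Fintype.linearIndependent_iff.1 hu d hd
  have h0 : 2 * c 0 - c 2 = 0 := h 0
  have h1 : 2 * c 1 - c 2 = 0 := h 1
  have h2 : c 2 - c 3 + c 4 = 0 := h 2
  have h3 : c 3 = 0 := h 3
  have h4 : -2 * c 4 = 0 := h 4
  have h5 : 2 * c 5 - c 4 = 0 := h 5
  have h6 : 2 * c 6 - c 4 = 0 := h 6
  simp only [Fin.forall_fin_succ, Fin.succ_zero_eq_one, Fin.succ_one_eq_two, Fin.reduceSucc,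
    IsEmpty.forall_iff, and_true]
  omega

open Polynomial in
theorem eq_zero_of_sum_algebraMap_mul_pow_eq {R A : Type*} [CommRing R] [CommRing A] [Algebra R A]
    {x : A} (hx : Transcendental R x) {s : Finset ℕ} {c : ℕ → R} {m : R}
    (h : ∑ i ∈ s, algebraMap R A (c i) * x ^ (i + 1) = algebraMap R A m) {i : ℕ} (hi : i ∈ s) :
    c i = 0 := by
  have hp : ∑ i ∈ s, C (c i) * X ^ (i + 1) - C m = 0 := by
    refine transcendental_iff.1 hx _ ?_
    simp only [map_sub, map_sum, map_mul, map_pow, aeval_C, aeval_X, h, sub_self]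
  have hcoeff := congrArg (coeff · (i + 1)) hp
  simpa [finsetSum_coeff, coeff_C_mul, coeff_X_pow, hi] using hcoeff

theorem linearIndependent_torus {τ : ℂ} (hτ : τ.im ≠ 0) {x : ℝ} (hx : Transcendental ℤ x) :
    LinearIndependent ℤ fun n : ℕ => (((x ^ (n + 1) : ℝ) : ℂ) : Torus τ) := by
  rw [linearIndependent_iff']
  intro s c hc i hi
  have hmem : ((∑ i ∈ s, c i * x ^ (i + 1) : ℝ) : ℂ) ∈ AddSubgroup.closure ({1, τ} : Set ℂ) := by
    rw [← QuotientAddGroup.eq_zero_iff, ← hc, ← QuotientAddGroup.mk'_apply]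
    simp only [Complex.ofReal_sum, map_sum, ← zsmul_eq_mul, Complex.ofReal_zsmul, map_zsmul,
      QuotientAddGroup.mk'_apply]
  obtain ⟨m, n, hmn⟩ := AddSubgroup.mem_closure_pair.1 hmem
  have hn : n = 0 := by
    simpa only [zsmul_eq_mul, mul_one, Complex.add_im, Complex.mul_im, Complex.intCast_im,
      Complex.intCast_re, zero_mul, add_zero, zero_add, Complex.ofReal_im, mul_eq_zero,
      Int.cast_eq_zero, hτ, or_false] using congrArg Complex.im hmn
  refine eq_zero_of_sum_algebraMap_mul_pow_eq hx (c := c) (m := m) ?_ hi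
  rw [hn, zero_smul, add_zero, zsmul_one] at hmn
  exact_mod_cast hmn.symm

theorem exists_isGeneric {τ : ℂ} (hτ : τ.im ≠ 0) :
    ∃ p : Parameters (Torus τ), p.Constraint ∧ p.IsGeneric :=
  exists_isGeneric_of_linearIndependent <|
    (linearIndependent_torus hτ (transcendental_liouvilleNumber le_rfl)).comp
      (Fin.val : Fin 7 → ℕ) Fin.val_injective

theorem preservingSubgroup_eq_extendedReflectionsB {τ : ℂ} (hτ : τ.im ≠ 0) :
    preservingSubgroup τ = extendedReflectionsB := by
  refine le_antisymm (fun w hw => ?_) (extendedReflectionsB_le_preservingSubgroup τ)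
  obtain ⟨p, hp, hgen⟩ := exists_isGeneric hτ
  exact mem_extendedReflectionsB_of_isGeneric hp hgen (weylE8_le_isometries hw.1) ((hw.2 p).2 hp)

end Generic

section Dihedral

variable {n : ℕ} {G : Type*} [Group G] {s t : G}

theorem zpow_cast_intCast (hs : s ^ n = 1) (k : ℤ) : s ^ ((k : ZMod n).cast : ℤ) = s ^ k := by
  refine zpow_eq_zpow_iff_modEq.2 (Int.ModEq.of_dvd ?_ ((ZMod.intCast_eq_intCast_iff _ _ n).1 ?_))
  · exact_mod_cast orderOf_dvd_of_pow_eq_one hs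
  · rw [ZMod.intCast_cast, ZMod.cast_id]

theorem zpow_mul_eq_mul_zpow_neg (ht : t ^ 2 = 1) (hts : (t * s) ^ 2 = 1) (k : ℤ) :
    s ^ k * t = t * s ^ (-k) := by
  have htt : t * t = 1 := by rw [← pow_two, ht]
  have h : SemiconjBy t s⁻¹ s := by
    rw [SemiconjBy, eq_comm, eq_mul_inv_iff_mul_eq]
    calc s * t * s = t * t * (s * t * s) := by rw [htt, one_mul]
      _ = t * (t * s) ^ 2 := by rw [pow_two]; group
      _ = t := by rw [hts, mul_one]
  rw [zpow_neg, ← inv_zpow]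
  exact (h.zpow_right k).eq.symm

/-- The homomorphism from the dihedral group of order `2 n` that sends the rotation `r 1` to `s`
and the reflection `sr 0` to `t`. -/
def dihedralLift (hs : s ^ n = 1) (ht : t ^ 2 = 1) (hts : (t * s) ^ 2 = 1) :
    DihedralGroup n →* G :=
  MonoidHom.mk' (fun
    | .r i => s ^ (i.cast : ℤ)
    | .sr i => t * s ^ (i.cast : ℤ)) (by
    have htt : t * t = 1 := by rw [← pow_two, ht]
    have hswap := zpow_mul_eq_mul_zpow_neg ht hts
    rintro (i | i) (j | j) <;> obtain ⟨i, rfl⟩ := ZMod.intCast_surjective i <;>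
      obtain ⟨j, rfl⟩ := ZMod.intCast_surjective j <;>
      simp only [DihedralGroup.r_mul_r, DihedralGroup.r_mul_sr, DihedralGroup.sr_mul_r,
        DihedralGroup.sr_mul_sr, ← Int.cast_add, ← Int.cast_sub, zpow_cast_intCast hs]
    · rw [zpow_add]
    · rw [← mul_assoc, hswap, mul_assoc, ← zpow_add, neg_add_eq_sub]
    · rw [zpow_add, mul_assoc]
    · rw [mul_assoc, ← mul_assoc (s ^ i), hswap, ← mul_assoc, ← mul_assoc, htt, one_mul,
        ← zpow_add, neg_add_eq_sub])

theorem dihedralLift_r_one (hs : s ^ n = 1) (ht : t ^ 2 = 1) (hts : (t * s) ^ 2 = 1) :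
    dihedralLift hs ht hts (.r 1) = s := by
  have := zpow_cast_intCast hs 1
  rwa [Int.cast_one, zpow_one] at this

theorem dihedralLift_sr_zero (hs : s ^ n = 1) (ht : t ^ 2 = 1) (hts : (t * s) ^ 2 = 1) :
    dihedralLift hs ht hts (.sr 0) = t := by
  have := zpow_cast_intCast hs 0
  rw [Int.cast_zero, zpow_zero] at this
  exact (congrArg (t * ·) this).trans (mul_one t)

theorem dihedralLift_range (hs : s ^ n = 1) (ht : t ^ 2 = 1) (hts : (t * s) ^ 2 = 1) :
    (dihedralLift hs ht hts).range = Subgroup.closure {s, t} := by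
  refine le_antisymm ?_ ((Subgroup.closure_le _).2 ?_)
  · have hs' : s ∈ Subgroup.closure {s, t} := Subgroup.subset_closure (by simp)
    have ht' : t ∈ Subgroup.closure {s, t} := Subgroup.subset_closure (by simp)
    rintro _ ⟨i | i, rfl⟩
    exacts [zpow_mem hs' _, mul_mem ht' (zpow_mem hs' _)]
  · rintro _ (rfl | rfl)
    exacts [⟨.r 1, dihedralLift_r_one ..⟩, ⟨.sr 0, dihedralLift_sr_zero ..⟩]

theorem dihedralGroup_hom_ext {f g : DihedralGroup n →* G} (hr : f (.r 1) = g (.r 1))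
    (hsr : f (.sr 0) = g (.sr 0)) : f = g := by
  have hrot (i : ZMod n) : f (.r i) = g (.r i) := by
    obtain ⟨k, rfl⟩ := ZMod.intCast_surjective i
    rw [← DihedralGroup.r_one_zpow, map_zpow, map_zpow, hr]
  ext (i | i)
  · exact hrot i
  · rw [← zero_add i, ← DihedralGroup.sr_mul_r, map_mul, map_mul, hsr, hrot]

/-- The homomorphism from the presented group to the dihedral group of order eight that sends the
generators to the rotation `r 1` and the reflection `sr 0`. -/
def presentedToDihedral : PresentedGroup dihedralRelators →* DihedralGroup 4 :=
  PresentedGroup.toGroup (f := ![.r 1, .sr 0]) (by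
    rintro r (rfl | rfl | rfl) <;> decide)

theorem presentedToDihedral_of_zero : presentedToDihedral (.of 0) = .r 1 :=
  PresentedGroup.toGroup.of (x := (0 : Fin 2)) _

theorem presentedToDihedral_of_one : presentedToDihedral (.of 1) = .sr 0 :=
  PresentedGroup.toGroup.of (x := (1 : Fin 2)) _

/-- The inverse of `presentedToDihedral`. -/
def dihedralToPresented : DihedralGroup 4 →* PresentedGroup dihedralRelators :=
  dihedralLift (s := .of 0) (t := .of 1)
    (PresentedGroup.one_of_mem (x := FreeGroup.of 0 ^ 4) (by simp [dihedralRelators]))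
    (PresentedGroup.one_of_mem (x := FreeGroup.of 1 ^ 2) (by simp [dihedralRelators]))
    (PresentedGroup.one_of_mem (x := (FreeGroup.of 1 * FreeGroup.of 0) ^ 2)
      (by simp [dihedralRelators]))

theorem dihedralToPresented_r_one : dihedralToPresented (.r 1) = .of 0 :=
  dihedralLift_r_one (t := PresentedGroup.of 1) _ _ _

theorem dihedralToPresented_sr_zero : dihedralToPresented (.sr 0) = .of 1 :=
  dihedralLift_sr_zero (s := PresentedGroup.of 0) _ _ _

/-- The dihedral group of order eight in its presentation by a rotation and a reflection. -/
def presentedEquivDihedral : PresentedGroup dihedralRelators ≃* DihedralGroup 4 :=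
  MonoidHom.toMulEquiv presentedToDihedral dihedralToPresented
    (by
      ext i
      fin_cases i
      · exact (congrArg _ presentedToDihedral_of_zero).trans dihedralToPresented_r_one
      · exact (congrArg _ presentedToDihedral_of_one).trans dihedralToPresented_sr_zero)
    (dihedralGroup_hom_ext
      ((congrArg presentedToDihedral dihedralToPresented_r_one).trans presentedToDihedral_of_zero)
      ((congrArg presentedToDihedral dihedralToPresented_sr_zero).trans presentedToDihedral_of_one))

end Dihedral

section DiagramAutomorphisms

theorem diagram1_pow_four : diagram1 ^ 4 = 1 := by ext i; revert i; decide

theorem diagram2_sq : diagram2 ^ 2 = 1 := by ext i; revert i; decide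

theorem diagram2_mul_diagram1_sq : (diagram2 * diagram1) ^ 2 = 1 := by ext i; revert i; decide

/-- The action of the dihedral group of order eight on the Dynkin diagram. -/
def dihedralToAut : DihedralGroup 4 →* autD6 :=
  dihedralLift diagram1_pow_four diagram2_sq diagram2_mul_diagram1_sq

theorem dihedralToAut_injective : Function.Injective dihedralToAut :=
  (injective_iff_map_eq_one _).2 fun x hx => by
    have h : ∀ x, (dihedralToAut x).1 0 = 0 → (dihedralToAut x).1 5 = 5 → x = 1 := by decide
    exact h x (by rw [hx]; rfl) (by rw [hx]; rfl)

theorem cartanD6_sq_apply_autD6 (π : autD6) (i j : Fin 7) :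
    (cartanD6 ^ 2) (π.1 i) (π.1 j) = (cartanD6 ^ 2) i j := by
  simp only [pow_two, Matrix.mul_apply]
  rw [← Equiv.sum_comp π.1]
  simp only [π.2 _ _]

theorem autD6_ext {π ρ : autD6} (h0 : π.1 0 = ρ.1 0) (h5 : π.1 5 = ρ.1 5) : π = ρ := by
  have hnode : ∀ i j : Fin 7, cartanD6 i 0 = cartanD6 j 0 → cartanD6 i 5 = cartanD6 j 5 →
      (cartanD6 ^ 2) i 0 = (cartanD6 ^ 2) j 0 → (cartanD6 ^ 2) i 5 = (cartanD6 ^ 2) j 5 →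
      i = j := by
    decide +kernel
  suffices ρ⁻¹ * π = 1 from (inv_mul_eq_one.1 this).symm
  have hfix {i : Fin 7} (hi : π.1 i = ρ.1 i) : (ρ⁻¹ * π).1 i = i := by
    simp [hi]
  ext i : 2
  refine hnode _ i ?_ ?_ ?_ ?_
  · conv_lhs => rw [← hfix h0, (ρ⁻¹ * π).2]
  · conv_lhs => rw [← hfix h5, (ρ⁻¹ * π).2]
  · conv_lhs => rw [← hfix h0, cartanD6_sq_apply_autD6]
  · conv_lhs => rw [← hfix h5, cartanD6_sq_apply_autD6]

theorem dihedralToAut_surjective : Function.Surjective dihedralToAut := fun π => by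
  have horbit : ∀ q ∈ Finset.univ.filter (fun q : Fin 7 × Fin 7 =>
      (cartanD6 ^ 2) q.1 q.1 = (cartanD6 ^ 2) 0 0 ∧ (cartanD6 ^ 2) q.2 q.2 = (cartanD6 ^ 2) 5 5 ∧
        (cartanD6 ^ 2) q.1 q.2 = (cartanD6 ^ 2) 0 5),
      q ∈ Finset.univ.image fun x => ((dihedralToAut x).1 0, (dihedralToAut x).1 5) := by
    decide +kernel
  obtain ⟨x, -, hx⟩ := Finset.mem_image.1 (horbit (π.1 0, π.1 5) (by
    simp only [Finset.mem_filter_univ, cartanD6_sq_apply_autD6, and_self]))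
  exact ⟨x, autD6_ext (congrArg Prod.fst hx) (congrArg Prod.snd hx)⟩

/-- The identification of the dihedral group of order eight with `Aut(D₆⁽¹⁾)`. -/
noncomputable def dihedralEquivAut : DihedralGroup 4 ≃* autD6 :=
  .ofBijective dihedralToAut ⟨dihedralToAut_injective, dihedralToAut_surjective⟩

theorem dihedralEquivAut_r_one : dihedralEquivAut (.r 1) = diagram1 :=
  dihedralLift_r_one diagram1_pow_four diagram2_sq diagram2_mul_diagram1_sq

theorem dihedralEquivAut_sr_zero : dihedralEquivAut (.sr 0) = diagram2 :=
  dihedralLift_sr_zero diagram1_pow_four diagram2_sq diagram2_mul_diagram1_sq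

end DiagramAutomorphisms

section GroupHoms

variable {ι G H K : Type*} [Group G] [Group H] [Group K]

/-- Two families in groups that satisfy the same relations generate isomorphic subgroups. -/
noncomputable def closureEquiv {a : ι → G} {b : ι → H}
    (h : (FreeGroup.lift a).ker = (FreeGroup.lift b).ker) :
    Subgroup.closure (Set.range a) ≃* Subgroup.closure (Set.range b) :=
  (MulEquiv.subgroupCongr FreeGroup.range_lift_eq_closure).symm.trans <|
    (QuotientGroup.quotientKerEquivRange (FreeGroup.lift a)).symm.trans <|
      (QuotientGroup.quotientMulEquivOfEq h).trans <|
        (QuotientGroup.quotientKerEquivRange (FreeGroup.lift b)).trans <|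
          MulEquiv.subgroupCongr FreeGroup.range_lift_eq_closure

theorem closureEquiv_apply {a : ι → G} {b : ι → H}
    (h : (FreeGroup.lift a).ker = (FreeGroup.lift b).ker) (i : ι) :
    (closureEquiv h ⟨a i, Subgroup.subset_closure ⟨i, rfl⟩⟩ : H) = b i := by
  have hof : (MulEquiv.subgroupCongr FreeGroup.range_lift_eq_closure).symm
      ⟨a i, Subgroup.subset_closure ⟨i, rfl⟩⟩ =
        QuotientGroup.quotientKerEquivRange (FreeGroup.lift a) (FreeGroup.of i) :=
    Subtype.ext (FreeGroup.lift_apply_of (f := a)).symm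
  rw [closureEquiv, MulEquiv.trans_apply, hof, MulEquiv.trans_apply, MulEquiv.symm_apply_apply]
  exact FreeGroup.lift_apply_of

theorem closure_hom_ext {s : Set G} {f g : Subgroup.closure s →* H}
    (h : ∀ x (hx : x ∈ s), f ⟨x, Subgroup.subset_closure hx⟩ = g ⟨x, Subgroup.subset_closure hx⟩) :
    f = g :=
  MonoidHom.eq_of_eqOn_dense Subgroup.closure_closure_coe_preimage fun x hx => h x hx

variable {φ : G →* MulAut H} {fn : H →* K} {fg : G →* K}
  (h : ∀ g, fn.comp (φ g).toMonoidHom = (MulAut.conj (fg g)).toMonoidHom.comp fn)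

theorem semidirectLift_range : (SemidirectProduct.lift fn fg h).range = fn.range ⊔ fg.range := by
  refine le_antisymm ?_ (sup_le ?_ ?_)
  · rintro _ ⟨x, rfl⟩
    exact mul_mem (Subgroup.mem_sup_left ⟨x.left, rfl⟩) (Subgroup.mem_sup_right ⟨x.right, rfl⟩)
  · rintro _ ⟨x, rfl⟩
    exact ⟨.inl x, SemidirectProduct.lift_inl ..⟩
  · rintro _ ⟨x, rfl⟩
    exact ⟨.inr x, SemidirectProduct.lift_inr ..⟩

theorem semidirectLift_injective (hfn : Function.Injective fn)
    (hfg : ∀ g, fg g ∈ fn.range → g = 1) :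
    Function.Injective (SemidirectProduct.lift fn fg h) := by
  refine (injective_iff_map_eq_one _).2 fun x hx => ?_
  have hmul : fn x.left * fg x.right = 1 := hx
  have hright : x.right = 1 :=
    hfg _ ⟨x.left⁻¹, by rw [map_inv, inv_eq_of_mul_eq_one_right hmul]⟩
  rw [hright, map_one, mul_one] at hmul
  exact SemidirectProduct.ext (hfn (hmul.trans (map_one fn).symm)) hright

end GroupHoms

section Isomorphism

theorem lift_wBeta_mem_constraintFixer (x : FreeGroup (Fin 7)) :
    FreeGroup.lift wBeta x ∈ constraintFixer :=
  reflectionsB_le_constraintFixer (FreeGroup.range_lift_eq_closure.le ⟨x, rfl⟩)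

theorem wBeta_rootMap (i : Fin 7) (v : RootLatticeD6) :
    wBeta i (rootMap v) = rootMap (simpleReflD6 i v) := by
  rw [wBeta_apply, inter_beta_rootMap, simpleReflD6, Module.reflection_apply, map_sub, map_smul,
    rootMap_single, neg_smul, ← sub_eq_add_neg, Fintype.linearCombination_apply]
  simp only [Matrix.mulVec, dotProduct, smul_eq_mul, mul_comm]

theorem lift_wBeta_rootMap (x : FreeGroup (Fin 7)) (v : RootLatticeD6) :
    FreeGroup.lift wBeta x (rootMap v) = rootMap (FreeGroup.lift simpleReflD6 x v) := by
  induction x using FreeGroup.induction_on generalizing v with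
  | C1 => rw [map_one, map_one]; rfl
  | of i => rw [FreeGroup.lift_apply_of, FreeGroup.lift_apply_of, wBeta_rootMap]
  | inv_of i ih =>
    rw [map_inv, map_inv, ← inv_apply_self (FreeGroup.lift wBeta (.of i))
      (rootMap ((FreeGroup.lift simpleReflD6 (.of i))⁻¹ v)), ih, apply_inv_self]
  | mul x y hx hy =>
    rw [map_mul, map_mul, LinearEquiv.mul_apply, LinearEquiv.mul_apply, hy, hx]

theorem ker_lift_simpleReflD6_eq :
    (FreeGroup.lift simpleReflD6).ker = (FreeGroup.lift wBeta).ker := by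
  ext x
  rw [MonoidHom.mem_ker, MonoidHom.mem_ker]
  constructor <;> intro hx
  · refine eq_one_of_apply_beta (lift_wBeta_mem_constraintFixer x) fun i => ?_
    rw [← rootMap_single, lift_wBeta_rootMap, hx, LinearEquiv.coe_one, id]
  · refine LinearEquiv.ext fun v => rootMap_injective ?_
    rw [← lift_wBeta_rootMap, hx]
    rfl

/-- The identification of `W(D₆⁽¹⁾)` with the group generated by the `w_{β_i}`. -/
noncomputable def weylEquivReflections : weylD6 ≃* reflectionsB :=
  closureEquiv ker_lift_simpleReflD6_eq

theorem weylEquivReflections_simpleReflD6 (i : Fin 7) :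
    (weylEquivReflections ⟨simpleReflD6 i, Subgroup.subset_closure ⟨i, rfl⟩⟩ : Pic ≃ₗ[ℤ] Pic) =
      wBeta i :=
  closureEquiv_apply _ i

theorem sigma1_pow_four : sigma1 ^ 4 = 1 := equiv_ext (by decide +kernel)

theorem sigma2_sq : sigma2 ^ 2 = 1 := equiv_ext (by decide +kernel)

theorem sigma2_mul_sigma1_sq : (sigma2 * sigma1) ^ 2 = 1 := equiv_ext (by decide +kernel)

/-- The action of the dihedral group of order eight on the Picard lattice by `σ₁` and `σ₂`. -/
def dihedralToPic : DihedralGroup 4 →* (Pic ≃ₗ[ℤ] Pic) :=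
  dihedralLift sigma1_pow_four sigma2_sq sigma2_mul_sigma1_sq

/-- The action of `Aut(D₆⁽¹⁾)` on the Picard lattice by `σ₁` and `σ₂`. -/
noncomputable def autToPic : autD6 →* (Pic ≃ₗ[ℤ] Pic) :=
  dihedralToPic.comp dihedralEquivAut.symm.toMonoidHom

theorem autToPic_diagram1 : autToPic diagram1 = sigma1 := by
  rw [← dihedralEquivAut_r_one]
  exact (congrArg dihedralToPic (dihedralEquivAut.symm_apply_apply _)).trans
    (dihedralLift_r_one _ _ _)

theorem autToPic_diagram2 : autToPic diagram2 = sigma2 := by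
  rw [← dihedralEquivAut_sr_zero]
  exact (congrArg dihedralToPic (dihedralEquivAut.symm_apply_apply _)).trans
    (dihedralLift_sr_zero _ _ _)

theorem range_autToPic : autToPic.range = Subgroup.closure {sigma1, sigma2} := by
  rw [autToPic, MonoidHom.range_comp, MonoidHom.range_eq_top.2 dihedralEquivAut.symm.surjective,
    ← MonoidHom.range_eq_map]
  exact dihedralLift_range ..

theorem autToPic_mem_isometries (π : autD6) : autToPic π ∈ isometries := by
  have hle : Subgroup.closure {sigma1, sigma2} ≤ extendedReflectionsB :=
    Subgroup.closure_mono Set.subset_union_right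
  exact weylE8_le_isometries (extendedReflectionsB_le_weylE8 (hle (range_autToPic.le ⟨π, rfl⟩)))

theorem autToPic_beta (π : autD6) (i : Fin 7) : autToPic π (beta i) = beta (π.1 i) := by
  have h : ∀ x i, dihedralToPic x (beta i) = beta ((dihedralToAut x).1 i) := by decide +kernel
  obtain ⟨x, rfl⟩ := dihedralEquivAut.surjective π
  rw [autToPic, MonoidHom.comp_apply]
  exact (congrArg (fun x => dihedralToPic x (beta i)) (dihedralEquivAut.symm_apply_apply x)).trans
    (h x i)

theorem sigma1_beta (i : Fin 7) : sigma1 (beta i) = beta (perm1 i) := by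
  rw [← autToPic_diagram1]
  exact autToPic_beta diagram1 i

theorem sigma2_beta (i : Fin 7) : sigma2 (beta i) = beta (perm2 i) := by
  rw [← autToPic_diagram2]
  exact autToPic_beta diagram2 i

theorem autAction_simpleReflD6 (π : autD6) (i : Fin 7) :
    autAction π ⟨simpleReflD6 i, Subgroup.subset_closure ⟨i, rfl⟩⟩ =
      ⟨simpleReflD6 (π.1 i), Subgroup.subset_closure ⟨π.1 i, rfl⟩⟩ :=
  Subtype.ext (permLattice_conj π i)

theorem weylEquivReflections_autAction (π : autD6) :
    (reflectionsB.subtype.comp weylEquivReflections.toMonoidHom).comp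
        (autAction π).toMonoidHom =
      (MulAut.conj (autToPic π)).toMonoidHom.comp
        (reflectionsB.subtype.comp weylEquivReflections.toMonoidHom) := by
  refine closure_hom_ext ?_
  rintro _ ⟨i, rfl⟩
  calc (weylEquivReflections (autAction π ⟨simpleReflD6 i, _⟩) : Pic ≃ₗ[ℤ] Pic)
    _ = wBeta (π.1 i) := by rw [autAction_simpleReflD6, weylEquivReflections_simpleReflD6]
    _ = autToPic π * wBeta i * (autToPic π)⁻¹ :=
      (refl_conj (autToPic_mem_isometries π) _ _ (autToPic_beta π i)).symm
    _ = _ := by rw [← weylEquivReflections_simpleReflD6]; rfl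

/-- The action of the extended affine Weyl group of type `D₆⁽¹⁾` on the Picard lattice. -/
noncomputable def extendedToPic : ExtendedWeylD6 →* (Pic ≃ₗ[ℤ] Pic) :=
  SemidirectProduct.lift _ autToPic weylEquivReflections_autAction

theorem extendedToPic_simpleGen (i : Fin 7) : extendedToPic (simpleGen i) = wBeta i :=
  (SemidirectProduct.lift_inl (h := weylEquivReflections_autAction) ..).trans
    (weylEquivReflections_simpleReflD6 i)

theorem extendedToPic_inr (π : autD6) : extendedToPic (.inr π) = autToPic π :=
  SemidirectProduct.lift_inr (h := weylEquivReflections_autAction) ..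

theorem extendedToPic_injective : Function.Injective extendedToPic := by
  refine semidirectLift_injective _
    (Subtype.val_injective.comp weylEquivReflections.injective) fun π hπ => ?_
  obtain ⟨x, hx⟩ := hπ
  refine Subtype.ext (perm_eq_one_of_apply_beta (reflectionsB_le_constraintFixer ?_)
    (autToPic_beta π))
  rw [← hx]
  exact (weylEquivReflections x).2

theorem range_extendedToPic : extendedToPic.range = extendedReflectionsB := by
  rw [extendedToPic, semidirectLift_range, range_autToPic, extendedReflectionsB,
    Subgroup.closure_union, MonoidHom.range_comp,
    MonoidHom.range_eq_top.2 weylEquivReflections.surjective, ← MonoidHom.range_eq_map,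
    Subgroup.range_subtype, reflectionsB]

theorem exists_extendedWeylD6_equiv {τ : ℂ} (hτ : τ.im ≠ 0) :
    ∃ Φ : ExtendedWeylD6 ≃* preservingSubgroup τ,
      (∀ i, (Φ (simpleGen i) : Pic ≃ₗ[ℤ] Pic) = wBeta i) ∧
      (Φ (.inr diagram1) : Pic ≃ₗ[ℤ] Pic) = sigma1 ∧
      (Φ (.inr diagram2) : Pic ≃ₗ[ℤ] Pic) = sigma2 := by
  have hrange : extendedToPic.range = preservingSubgroup τ := by
    rw [range_extendedToPic, preservingSubgroup_eq_extendedReflectionsB hτ]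
  exact ⟨(MonoidHom.ofInjective extendedToPic_injective).trans (.subgroupCongr hrange),
    extendedToPic_simpleGen, (extendedToPic_inr _).trans autToPic_diagram1,
    (extendedToPic_inr _).trans autToPic_diagram2⟩

end Isomorphism

section Mapping

theorem delta_eq_beta : delta = beta 0 + beta 1 + (2 : ℤ) • beta 2 + (2 : ℤ) • beta 3 +
    (2 : ℤ) • beta 4 + beta 5 + beta 6 := by
  decide

theorem beta_eq_alpha : beta 0 = alpha 0 ∧ beta 1 = alpha 6 ∧
    beta 2 = alpha 2 + alpha 3 + alpha 4 + alpha 5 ∧ beta 3 = alpha 1 ∧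
    beta 4 = alpha 0 + alpha 2 + (2 : ℤ) • alpha 3 + alpha 4 + alpha 5 + alpha 6 + alpha 7 ∧
    beta 5 = alpha 4 ∧ beta 6 = alpha 8 := by
  decide

theorem isTranslationOn_span {s : Set Pic} {f : Pic ≃ₗ[ℤ] Pic}
    (h : ∀ x ∈ s, ∃ n : ℤ, f x = x + n • delta) : IsTranslationOn (Submodule.span ℤ s) f := by
  intro x hx
  induction hx using Submodule.span_induction with
  | mem x hx => exact h x hx
  | zero => exact ⟨0, by rw [map_zero, zero_smul, add_zero]⟩
  | add x y _ _ hx hy =>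
    obtain ⟨⟨m, hm⟩, ⟨n, hn⟩⟩ := And.intro hx hy
    exact ⟨m + n, by rw [map_add, hm, hn, add_smul, add_add_add_comm]⟩
  | smul c x _ hx =>
    obtain ⟨m, hm⟩ := hx
    exact ⟨c * m, by rw [map_smul, hm, smul_add, mul_smul]⟩

theorem phiPull_beta : phiPull (beta 0) = -beta 5 ∧ phiPull (beta 1) = -beta 6 ∧
    phiPull (beta 2) = -beta 3 - beta 4 ∧
    phiPull (beta 3) = beta 3 + (2 : ℤ) • beta 4 + beta 5 + beta 6 ∧
    phiPull (beta 4) = beta 0 + beta 1 + beta 2 + beta 3 ∧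
    phiPull (beta 5) = -beta 0 ∧ phiPull (beta 6) = -beta 1 := by
  decide +kernel

theorem phiPull_not_isTranslationOn : ¬ IsTranslationOn latticeB phiPull := by
  intro h
  obtain ⟨n, hn⟩ := h (beta 0) (Submodule.subset_span ⟨0, rfl⟩)
  have hE1 : (phiPull (beta 0) - beta 0) (.inr 0) = -1 := by decide +kernel
  have hE2 : (phiPull (beta 0) - beta 0) (.inr 1) = 1 := by decide +kernel
  have hδ : delta (.inr 0) = -1 ∧ delta (.inr 1) = -1 := by decide +kernel
  rw [hn, add_sub_cancel_left, Pi.smul_apply, smul_eq_mul] at hE1 hE2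
  rw [hδ.1] at hE1
  rw [hδ.2] at hE2
  omega

theorem phiPull_sq_beta : ∀ i, (phiPull ^ 2) (beta i) =
    beta i + (![0, 0, -1, 1, 0, 0, 0] : Fin 7 → ℤ) i • delta := by
  decide +kernel

theorem phiPull_sq_isTranslationOn : IsTranslationOn latticeB (phiPull ^ 2) := by
  refine isTranslationOn_span ?_
  rintro _ ⟨i, rfl⟩
  exact ⟨_, phiPull_sq_beta i⟩

theorem phiPull_word : phiPull = sigma1 ^ 3 * wBeta 6 * wBeta 5 * wBeta 3 * wBeta 2 * wBeta 1 *
    wBeta 0 * wBeta 2 * wBeta 1 * wBeta 0 :=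
  equiv_ext (by decide +kernel)

theorem phiPull_sq_word : phiPull ^ 2 = sigma1 ^ 2 * wBeta 3 * wBeta 4 * wBeta 6 * wBeta 5 *
    wBeta 4 * wBeta 3 * wBeta 2 * wBeta 1 * wBeta 0 * wBeta 2 :=
  equiv_ext (by decide +kernel)

theorem phiPush_word : phiPush = wBeta 0 * wBeta 1 * wBeta 2 * wBeta 0 * wBeta 1 * wBeta 2 *
    wBeta 3 * wBeta 5 * wBeta 6 * sigma1 :=
  equiv_ext (by decide +kernel)

theorem phiPush_sq_word : phiPush ^ 2 = wBeta 2 * wBeta 0 * wBeta 1 * wBeta 2 * wBeta 3 *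
    wBeta 4 * wBeta 5 * wBeta 6 * wBeta 4 * wBeta 3 * sigma1 ^ 2 :=
  equiv_ext (by decide +kernel)

end Mapping

end EllipticD6

open EllipticD6 in
theorem mainTheorem1 (τ : ℂ) (hτ : 0 < τ.im) :
    -- the subgroup preserving the constraint is generated by the reflections and `σ₁, σ₂`
    preservingSubgroup τ = Subgroup.closure (Set.range wBeta ∪ {sigma1, sigma2}) ∧
    -- for membership one direction is enough
    (∀ w ∈ weylE8, (∀ p : Parameters (Torus τ), p.Constraint → (p.evolve w).Constraint) →
      w ∈ preservingSubgroup τ) ∧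
    -- and so is a single generic point of the constrained family, which has such points
    (∃ p : Parameters (Torus τ), p.Constraint ∧ p.IsGeneric) ∧
    (∀ p : Parameters (Torus τ), p.Constraint → p.IsGeneric →
      ∀ w ∈ weylE8, (p.evolve w).Constraint → w ∈ preservingSubgroup τ) ∧
    -- it is isomorphic to the extended affine Weyl group, generators going to generators
    (∃ Φ : ExtendedWeylD6 ≃* preservingSubgroup τ,
      (∀ i, (Φ (simpleGen i) : Pic ≃ₗ[ℤ] Pic) = wBeta i) ∧
      (Φ (SemidirectProduct.inr diagram1) : Pic ≃ₗ[ℤ] Pic) = sigma1 ∧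
      (Φ (SemidirectProduct.inr diagram2) : Pic ≃ₗ[ℤ] Pic) = sigma2) ∧
    -- the `β_i` in terms of the `α_i`
    (beta 0 = alpha 0 ∧ beta 1 = alpha 6 ∧
      beta 2 = alpha 2 + alpha 3 + alpha 4 + alpha 5 ∧ beta 3 = alpha 1 ∧
      beta 4 = alpha 0 + alpha 2 + (2 : ℤ) • alpha 3 + alpha 4 + alpha 5 + alpha 6 + alpha 7 ∧
      beta 5 = alpha 4 ∧ beta 6 = alpha 8) ∧
    -- the `β_i` are linearly independent with the Dynkin diagram of type `D₆⁽¹⁾`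
    (LinearIndependent ℤ beta ∧ ∀ i j, inter (beta i) (beta j) = -cartanD6 i j) ∧
    -- the diagram automorphisms form the dihedral group of order eight
    (∃ χ : DihedralGroup 4 ≃* autD6,
      χ (DihedralGroup.r 1) = diagram1 ∧ χ (DihedralGroup.sr 0) = diagram2) ∧
    (∃ χ : PresentedGroup dihedralRelators ≃* autD6,
      χ (PresentedGroup.of 0) = diagram1 ∧ χ (PresentedGroup.of 1) = diagram2) ∧
    -- `σ₁, σ₂` permute the `β_i` accordingly
    (∀ i, sigma1 (beta i) = beta (perm1 i) ∧ sigma2 (beta i) = beta (perm2 i)) ∧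
    -- the action of `φ^*`, which is not a translation on `Q_B`
    (phiPull (beta 0) = -beta 5 ∧ phiPull (beta 1) = -beta 6 ∧
      phiPull (beta 2) = -beta 3 - beta 4 ∧
      phiPull (beta 3) = beta 3 + (2 : ℤ) • beta 4 + beta 5 + beta 6 ∧
      phiPull (beta 4) = beta 0 + beta 1 + beta 2 + beta 3 ∧
      phiPull (beta 5) = -beta 0 ∧ phiPull (beta 6) = -beta 1) ∧
    ¬ IsTranslationOn latticeB phiPull ∧
    -- the action of `(φ²)^*`, which is a translation on `Q_B`
    (∀ i, (phiPull ^ 2) (beta i) = beta i + (![0, 0, -1, 1, 0, 0, 0] : Fin 7 → ℤ) i • delta) ∧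
    IsTranslationOn latticeB (phiPull ^ 2) ∧
    delta = beta 0 + beta 1 + (2 : ℤ) • beta 2 + (2 : ℤ) • beta 3 + (2 : ℤ) • beta 4
      + beta 5 + beta 6 ∧
    -- the words of `φ^*` and `(φ²)^*`, and the inverse words of `φ_*` and `(φ²)_*`
    phiPull = sigma1 ^ 3 * wBeta 6 * wBeta 5 * wBeta 3 * wBeta 2 * wBeta 1 * wBeta 0 *
      wBeta 2 * wBeta 1 * wBeta 0 ∧
    phiPull ^ 2 = sigma1 ^ 2 * wBeta 3 * wBeta 4 * wBeta 6 * wBeta 5 * wBeta 4 * wBeta 3 *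
      wBeta 2 * wBeta 1 * wBeta 0 * wBeta 2 ∧
    phiPush = wBeta 0 * wBeta 1 * wBeta 2 * wBeta 0 * wBeta 1 * wBeta 2 * wBeta 3 *
      wBeta 5 * wBeta 6 * sigma1 ∧
    phiPush ^ 2 = wBeta 2 * wBeta 0 * wBeta 1 * wBeta 2 * wBeta 3 * wBeta 4 * wBeta 5 *
      wBeta 6 * wBeta 4 * wBeta 3 * sigma1 ^ 2 ∧
    -- the effect of `σ₁²` on the Dynkin diagram
    perm1 ^ 2 = c[0, 1] * c[5, 6] := by
  refine ⟨preservingSubgroup_eq_extendedReflectionsB hτ.ne', fun w hw h => ?_,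
    exists_isGeneric hτ.ne', fun p hp hgen w hw h =>
      mem_preservingSubgroup_of_isGeneric hp hgen hw h,
    exists_extendedWeylD6_equiv hτ.ne', beta_eq_alpha, ⟨linearIndependent_beta, inter_beta⟩,
    ⟨dihedralEquivAut, dihedralEquivAut_r_one, dihedralEquivAut_sr_zero⟩,
    ⟨presentedEquivDihedral.trans dihedralEquivAut,
      (congrArg dihedralEquivAut presentedToDihedral_of_zero).trans dihedralEquivAut_r_one,
      (congrArg dihedralEquivAut presentedToDihedral_of_one).trans dihedralEquivAut_sr_zero⟩,
    fun i => ⟨sigma1_beta i, sigma2_beta i⟩, phiPull_beta, phiPull_not_isTranslationOn,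
    phiPull_sq_beta, phiPull_sq_isTranslationOn, delta_eq_beta, phiPull_word, phiPull_sq_word,
    phiPush_word, phiPush_sq_word, by decide⟩
  obtain ⟨p, hp, hgen⟩ := exists_isGeneric hτ.ne'
  exact mem_preservingSubgroup_of_isGeneric hp hgen hw (h p hp)
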